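/- **Systems.** Let $\mathsf{LHomeo}$ be the class of pairs $(X,\sigma)$ where $X$ is a non-empty totally disconnected compact metrizable space and $\sigma\colon X\to X$ is a surjective local homeomorphism. Write $(X_1,\sigma_1)\sim_{t.c.}(X_2,\sigma_2)$ if there is a homeomorphism $h\colon X_1\to X_2$ with $h\circ\sigma_1=\sigma_2\circ h$. **$l$-diagrams.** A separated Bratteli diagram $(F,D)$ consists of finite non-empty vertex sets $F^{0,n}$ and edge sets $F^{1,n}$ $(n\ge 0)$, surjective maps $r\colon F^{1,n}\to F^{0,n}$ and $s\colon F^{1,n}\to F^{0,n+1}$, and for each vertex $v$ a partition $D_v$ of $r^{-1}(v)$ into non-empty sets. It is an $l$-diagram if its edges are coloured blue or red (let $B_v$, $R_v$ be the sets of blue and of red edges with range $v$) and each red edge $f$ of an even layer has a set $R(f)\subseteq R_{s(f)}$ such that: (a) for $v\in F^{0,2j}$, $j\ge 0$: $D_v=\{B_v,R_v\}$, and $B_v,R_v$ are non-empty; (b) for $v\in F^{0,2j-1}$, $j\ge 1$: $D_v=\{B_v\}\cup\{R(f)\mid f \text{ red},\ s(f)=v\}$, where $B_v$ and all these $R(f)$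 are non-empty, and $R_v$ is the union of these $R(f)$, which are pairwise disjoint for distinct $f$; (c) for $j\ge1$: $F^{0,2j}=\bigsqcup_{v\in F^{0,2j-1}}s(B_v)=\bigsqcup_{v\in F^{0,2j-1}}s(R_v)$, and $s$ is injective on $B_v$ and on $R_v$ for each $v\in F^{0,2j-1}$; (d) $F^{0,1}=\bigsqcup_{v\in F^{0,0}}s(B_v)=\bigcup_{v\in F^{0,0}}s(R_v)$, and $s$ is injective on the blue edges of $F^{1,2j}$ for each $j\ge 0$; (e) for $v\in F^{0,2j}$, $j\ge 0$: $\bigsqcup_{e\in B_v}s(B_{s(e)})=\bigsqcup_{f\in R_v}s(R(f))$; (f) for $j\ge 1$, $v\in F^{0,2j-1}$ and red edges $f_0,f_1$ with $r(f_0)=v$, $s(f_0)=r(f_1)$, there is a unique pair of blue edges $e_0,e_1$ with $r(e_0)=v$, $s(e_0)=r(e_1)$, $s(e_1)=s(f_1)$; (g) for $j\ge 1$, $v\in F^{0,2j-1}$, a red edge $g$ with $s(g)=v$ and blue edges $e_0,e_1$ with $r(e_0)=v$, $s(e_0)=r(e_1)$, there is a unique pair of red edges $f_0,f_1$ with $f_0\in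 R(g)$, $r(f_0)=v$, $s(f_0)=r(f_1)$, $s(f_1)=s(e_1)$. Let $\mathsf{LDiag}$ be the class of $l$-diagrams. An isomorphism of $l$-diagrams is a layer-preserving graph isomorphism that respects the separations, the sets $B_v$, $R_v$ and the sets $R(f)$. Given integers $0\le m_0<m_1<\cdots$ with $m_0$ even and all $m_{n+1}-m_n$ odd, the contraction of $(F,D)$ has vertex sets $F^{0,m_n}$; its blue edges in layer $n$ are the paths $(e_{m_n},\dots,e_{m_{n+1}-1})$ with $e_i\in F^{1,i}$, $s(e_i)=r(e_{i+1})$ and all $e_i$ blue; its red edges are the paths $(f_{m_n},\dots,f_{m_{n+1}-1})$ of red edges with $f_{i+1}\in R(f_i)$ for even $i$; the range and source of a path are the range of its first edge and the source of its last edge; for $n$ even and a red edge $\hat f$ of layer $n$, the set $R'(\hat f)$ consists of the red edges of layer $n+1$ whose first member lies in $R(\text{last member of }\hat f)$; the separations are given by (a) and (b). Let $\sim_l$ be the equivalence relation on $\mathsf{LDiag}$ generated by isomorphism and contraction. **From systems to diagrams.** A partition of $X$ is a finite family of non-empty pairwise disjoint clopen sets covering $X$; $\mathcal P\precsim\mathcal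 Q$ means that every member of $\mathcal Q$ lies in a member of $\mathcal P$; $\mathcal P\vee\mathcal Q$ is the family of non-empty intersections $Z\cap Z'$ with $Z\in\mathcal P$, $Z'\in\mathcal Q$. Let $\mathcal U_{\ge k}$ be the set of points with at least $k$ preimages under $\sigma$, let $\mathcal P^\sigma$ be the family of non-empty sets $(\sigma(Z_1)\cap\dots\cap\sigma(Z_k))\setminus\mathcal U_{\ge k+1}$ with $k\ge 1$ and $Z_1,\dots,Z_k\in\mathcal P$ distinct, and let $\sigma^{-1}(\mathcal P)=\{\sigma^{-1}(Z)\mid Z\in\mathcal P\}$. A $\sigma$-refined sequence is a sequence of partitions $\mathcal P_0\precsim\mathcal P_1\precsim\cdots$ such that $\sigma|_Z$ is a homeomorphism onto its image for each $Z\in\mathcal P_0$, $\bigcup_n\mathcal P_n$ generates the topology, the maximal diameter of the members of $\mathcal P_n$ (for a compatible metric) tends to $0$, and for all $j\ge 0$: $\mathcal P_{2j}\vee\mathcal P_{2j}^\sigma\precsim\mathcal P_{2j+1}$ and $\mathcal P_{2j+1}\vee\sigma^{-1}(\mathcal P_{2j+1})\precsim\mathcal P_{2j+2}$. Its diagram has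 $F^{0,n}=\mathcal P_n$, with one blue edge from $Z'\in\mathcal P_{n+1}$ to $Z\in\mathcal P_n$ whenever $Z'\subseteq Z$, and one red edge whenever $Z'\subseteq\sigma(Z)$ ($n$ even), respectively $Z'\subseteq\sigma^{-1}(Z)$ ($n$ odd); for a red edge $f$ of an even layer, $R(f)$ is the set of red edges $g$ with $r(g)=s(f)$ (as vertices) and $s(g)\subseteq r(f)$ (as sets); the separations are given by (a) and (b). **From diagrams to systems.** For an $l$-diagram $(F,D)$ let $X_F$ be the space of infinite sequences $(e_0,e_1,\dots)$ of blue edges $e_n\in F^{1,n}$ with $s(e_n)=r(e_{n+1})$, with the topology generated by the cylinder sets. Define $\sigma_F(e_0,e_1,\dots)=(e_0',e_1',\dots)$ if there are red edges $f_n\in F^{1,n}$ with $s(f_n)=r(f_{n+1})$ for all $n$ such that for even $n$: $r(f_n)=r(e_n)$, $s(f_{n+1})=s(e_{n+1})$, $f_{n+1}\in R(f_n)$, and for odd $n$: $r(e'_n)=r(f_n)$, $s(e'_{n+1})=s(f_{n+1})$. **Theorem.** Every $(X,\sigma)\in\mathsf{LHomeo}$ has a $\sigma$-refined sequence of partitions,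 and the diagram of every such sequence is an $l$-diagram. For every $l$-diagram $(F,D)$ the rule above defines a map $\sigma_F\colon X_F\to X_F$, and $(X_F,\sigma_F)\in\mathsf{LHomeo}$. There are well-defined maps $$\Phi\colon\mathsf{LHomeo}/{\sim_{t.c.}}\to\mathsf{LDiag}/{\sim_l},\qquad \Psi\colon\mathsf{LDiag}/{\sim_l}\to\mathsf{LHomeo}/{\sim_{t.c.}}$$ such that $\Phi$ sends the class of $(X,\sigma)$ to the class of the diagram of any $\sigma$-refined sequence of partitions of $X$, and $\Psi$ sends the class of $(F,D)$ to the class of $(X_F,\sigma_F)$. These maps are inverse to each other: $\Psi\circ\Phi=\mathrm{id}$ and $\Phi\circ\Psi=\mathrm{id}$. -/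

import Mathlib

universe u

namespace LCorr

/-! ### Dynamical systems -/

/-- `σ` is a surjective local homeomorphism of a non-empty, totally disconnected, compact
metrizable space. -/
structure IsLHomeo {X : Type u} [TopologicalSpace X] (σ : X → X) : Prop where
  nonempty : Nonempty X
  compact : CompactSpace X
  metrizable : TopologicalSpace.MetrizableSpace X
  totallyDisconnected : TotallyDisconnectedSpace X
  isLocalHomeomorph : IsLocalHomeomorph σ
  surjective : Function.Surjective σ

/-- The class of systems `(X, σ)`. -/
structure LHomeo : Type (u + 1) where
  X : Type u
  [top : TopologicalSpace X]
  σ : X → X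
  isLHomeo : IsLHomeo σ

attribute [instance] LHomeo.top

/-- Topological conjugacy. -/
def LHomeo.Conj (S T : LHomeo.{u}) : Prop :=
  ∃ h : S.X ≃ₜ T.X, ∀ x, h (S.σ x) = T.σ (h x)

instance LHomeo.setoid : Setoid LHomeo.{u} where
  r := LHomeo.Conj
  iseqv :=
    { refl := fun S => ⟨Homeomorph.refl S.X, fun _ => rfl⟩
      symm := by
        rintro S T ⟨h, hh⟩
        refine ⟨h.symm, fun y => ?_⟩
        apply h.injective
        rw [hh, h.apply_symm_apply, h.apply_symm_apply]
      trans := by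
        rintro S T U ⟨h, hh⟩ ⟨k, hk⟩
        refine ⟨h.trans k, fun x => ?_⟩
        simp only [Homeomorph.trans_apply, hh, hk] }

/-! ### Layered separated graphs and `l`-diagrams -/

/-- The family `C` is a partition of the set `A` into pairwise disjoint non-empty subsets. -/
def IsSetPartition {α : Type u} (C : Set (Set α)) (A : Set α) : Prop :=
  (∀ Y ∈ C, Y.Nonempty) ∧ C.PairwiseDisjoint id ∧ ⋃₀ C = A

/-- The data of a graph whose vertices and edges are arranged in layers `V n`, `E n`, `n ≥ 0`,
the edges of `E n` having range in `V n` and source in `V (n + 1)`, together with a family `D v`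
of sets of edges for every vertex `v`, a set of blue edges (the other edges are the red ones) and
a set `R f` of edges of the next layer for every edge `f`.  The sets `R f` are only used for red
edges `f` of even layers. -/
structure ColoredDiagram : Type (u + 1) where
  V : ℕ → Type u
  E : ℕ → Type u
  r : ∀ {n : ℕ}, E n → V n
  s : ∀ {n : ℕ}, E n → V (n + 1)
  D : ∀ {n : ℕ}, V n → Set (Set (E n))
  blue : ∀ {n : ℕ}, Set (E n)
  R : ∀ {n : ℕ}, E n → Set (E (n + 1))

namespace ColoredDiagram

variable (F : ColoredDiagram.{u})

/-- The set of red edges of a layer. -/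
def red {n : ℕ} : Set (F.E n) := {f | f ∉ F.blue}

/-- The set `B_v` of blue edges with range `v`. -/
def B {n : ℕ} (v : F.V n) : Set (F.E n) := {e | e ∈ F.blue ∧ F.r e = v}

/-- The set `R_v` of red edges with range `v`. -/
def Rv {n : ℕ} (v : F.V n) : Set (F.E n) := {f | f ∈ F.red ∧ F.r f = v}

/-- The underlying layered separated graph is a separated Bratteli diagram. -/
structure IsSeparatedBratteli : Prop where
  finite_V : ∀ n, Finite (F.V n)
  nonempty_V : ∀ n, Nonempty (F.V n)
  finite_E : ∀ n, Finite (F.E n)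
  nonempty_E : ∀ n, Nonempty (F.E n)
  range_surjective : ∀ n, Function.Surjective (fun e : F.E n => F.r e)
  source_surjective : ∀ n, Function.Surjective (fun e : F.E n => F.s e)
  partition : ∀ n (v : F.V n), IsSetPartition (F.D v) {e | F.r e = v}

/-- The axioms of an `l`-diagram. -/
structure IsLDiagram : Prop extends F.IsSeparatedBratteli where
  /-- (a) Separations at the vertices of the even layers. -/
  sep_even : ∀ n, Even n → ∀ v : F.V n, F.D v = {F.B v, F.Rv v}
  blue_nonempty : ∀ n (v : F.V n), (F.B v).Nonempty
  red_nonempty : ∀ n, Even n → ∀ v : F.V n, (F.Rv v).Nonempty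
  /-- (b) Separations at the vertices of the odd layers: blue edges, and one class of red edges
  for each red edge `f` that starts at the vertex. -/
  sep_odd : ∀ n, Even n → ∀ v : F.V (n + 1),
    F.D v = {F.B v} ∪ {Y | ∃ f : F.E n, f ∈ F.red ∧ F.s f = v ∧ Y = F.R f}
  R_nonempty : ∀ n, Even n → ∀ f : F.E n, f ∈ F.red → (F.R f).Nonempty
  R_iUnion : ∀ n, Even n → ∀ v : F.V (n + 1),
    F.Rv v = ⋃ f ∈ {f : F.E n | f ∈ F.red ∧ F.s f = v}, F.R f
  R_disjoint : ∀ n, Even n → ∀ v : F.V (n + 1),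
    {f : F.E n | f ∈ F.red ∧ F.s f = v}.PairwiseDisjoint (fun f => F.R f)
  /-- (c) Vertices at the even layers of positive index. -/
  even_blue : ∀ n, Odd n → ⋃ v : F.V n, F.s '' F.B v = Set.univ
  even_blue_disjoint : ∀ n, Odd n → Pairwise fun v w : F.V n =>
    Disjoint (F.s '' F.B v) (F.s '' F.B w)
  even_red : ∀ n, Odd n → ⋃ v : F.V n, F.s '' F.Rv v = Set.univ
  even_red_disjoint : ∀ n, Odd n → Pairwise fun v w : F.V n =>
    Disjoint (F.s '' F.Rv v) (F.s '' F.Rv w)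
  even_blue_inj : ∀ n, Odd n → ∀ v : F.V n, Set.InjOn F.s (F.B v)
  even_red_inj : ∀ n, Odd n → ∀ v : F.V n, Set.InjOn F.s (F.Rv v)
  /-- (d) Vertices at the first odd layer, and injectivity of the source map on the blue edges
  that end at an even layer. -/
  first_blue : ⋃ v : F.V 0, F.s '' F.B v = Set.univ
  first_blue_disjoint : Pairwise fun v w : F.V 0 =>
    Disjoint (F.s '' F.B v) (F.s '' F.B w)
  first_red : ⋃ v : F.V 0, F.s '' F.Rv v = Set.univ
  odd_blue_inj : ∀ n, Even n → Set.InjOn F.s (F.blue : Set (F.E n))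
  /-- (e) Compatibility at the even layers. -/
  compat : ∀ n, Even n → ∀ v : F.V n,
    ⋃ e ∈ F.B v, F.s '' F.B (F.s e) = ⋃ f ∈ F.Rv v, F.s '' F.R f
  compat_blue_disjoint : ∀ n, Even n → ∀ v : F.V n,
    (F.B v).PairwiseDisjoint fun e => F.s '' F.B (F.s e)
  compat_red_disjoint : ∀ n, Even n → ∀ v : F.V n,
    (F.Rv v).PairwiseDisjoint fun f => F.s '' F.R f
  /-- (f) Rombs at the odd layers, from red to blue. -/
  romb_red : ∀ n, Odd n → ∀ (f₀ : F.E n) (f₁ : F.E (n + 1)), f₀ ∈ F.red → f₁ ∈ F.red →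
    F.s f₀ = F.r f₁ →
    ∃! e : F.E n × F.E (n + 1), e.1 ∈ F.blue ∧ e.2 ∈ F.blue ∧
      F.r e.1 = F.r f₀ ∧ F.s e.1 = F.r e.2 ∧ F.s e.2 = F.s f₁
  /-- (g) Rombs at the odd layers, from blue to red. -/
  romb_blue : ∀ n, Even n → ∀ (g : F.E n) (e₀ : F.E (n + 1)) (e₁ : F.E (n + 2)),
    g ∈ F.red → e₀ ∈ F.blue → e₁ ∈ F.blue → F.r e₀ = F.s g → F.s e₀ = F.r e₁ →
    ∃! f : F.E (n + 1) × F.E (n + 2), f.1 ∈ F.red ∧ f.2 ∈ F.red ∧ f.1 ∈ F.R g ∧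
      F.r f.1 = F.r e₀ ∧ F.s f.1 = F.r f.2 ∧ F.s f.2 = F.s e₁

/-- The separation determined by the colours: `{B_v, R_v}` at even layers, and
`{B_v} ∪ {R f | f red, s f = v}` at odd layers. -/
def colorSeparation {V E : ℕ → Type u} (r : ∀ {n : ℕ}, E n → V n)
    (s : ∀ {n : ℕ}, E n → V (n + 1)) (blue : ∀ {n : ℕ}, Set (E n))
    (R : ∀ {n : ℕ}, E n → Set (E (n + 1))) : ∀ {n : ℕ}, V n → Set (Set (E n))
  | 0, v => {{e | e ∈ blue ∧ r e = v}, {e | e ∉ blue ∧ r e = v}}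
  | n + 1, v =>
    {Y | Y = {e | e ∈ blue ∧ r e = v} ∨
      (Even (n + 1) ∧ Y = {e | e ∉ blue ∧ r e = v}) ∨
      (Odd (n + 1) ∧ ∃ f : E n, f ∉ blue ∧ s f = v ∧ Y = R f)}

/-! ### Isomorphism and contraction -/

/-- Isomorphism of separated diagrams that respects the colours and the sets `R f`. -/
def Iso (F G : ColoredDiagram.{u}) : Prop :=
  ∃ (φ₀ : ∀ n, F.V n ≃ G.V n) (φ₁ : ∀ n, F.E n ≃ G.E n),
    (∀ n (e : F.E n), G.r (φ₁ n e) = φ₀ n (F.r e)) ∧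
    (∀ n (e : F.E n), G.s (φ₁ n e) = φ₀ (n + 1) (F.s e)) ∧
    (∀ n (v : F.V n), (fun Y => φ₁ n '' Y) '' F.D v = G.D (φ₀ n v)) ∧
    (∀ n (v : F.V n), φ₁ n '' F.B v = G.B (φ₀ n v)) ∧
    (∀ n (v : F.V n), φ₁ n '' F.Rv v = G.Rv (φ₀ n v)) ∧
    (∀ n, Even n → ∀ f : F.E n, f ∈ F.red → φ₁ (n + 1) '' F.R f = G.R (φ₁ n f))

/-- A finite path `(e_j, …, e_{l-1})`, recorded together with the vertices that it visits: its
range is `vert j` and its source is `vert l`. -/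
structure FinPath (j l : ℕ) : Type u where
  vert : ∀ i, j ≤ i → i ≤ l → F.V i
  edge : ∀ i, j ≤ i → i < l → F.E i
  range_edge : ∀ i (h : j ≤ i) (h' : i < l), F.r (edge i h h') = vert i h h'.le
  source_edge : ∀ i (h : j ≤ i) (h' : i < l),
    F.s (edge i h h') = vert (i + 1) (h.trans i.le_succ) h'

/-- The blue paths from layer `l` to layer `j`. -/
def BluePath (j l : ℕ) : Type u :=
  {p : F.FinPath j l // ∀ i (h : j ≤ i) (h' : i < l), p.edge i h h' ∈ F.blue}

/-- The red paths from layer `l` to layer `j`, where `f_{i+1} ∈ R(f_i)` for even `i`. -/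
def RedPath (j l : ℕ) : Type u :=
  {p : F.FinPath j l // (∀ i (h : j ≤ i) (h' : i < l), p.edge i h h' ∈ F.red) ∧
    ∀ i (h : j ≤ i) (h' : i + 1 < l), Even i →
      p.edge (i + 1) (h.trans i.le_succ) h' ∈ F.R (p.edge i h (i.lt_succ_self.trans h'))}

/-- The admissible sequences for contractions. -/
def IsContractionSeq (m : ℕ → ℕ) : Prop :=
  StrictMono m ∧ Even (m 0) ∧ ∀ n, m (n + 1) - m n ≡ 1 [MOD 2]

/-- The path underlying an edge of the contraction. -/
def edgePath {j l : ℕ} : F.BluePath j l ⊕ F.RedPath j l → F.FinPath j l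
  | Sum.inl e => e.1
  | Sum.inr f => f.1

/-- The sets `R'(f)` of the contraction: `R'(f)` consists of the red paths whose first edge lies
in the set `R` of the last edge of `f`. -/
def contractR (m : ℕ → ℕ) (hm : StrictMono m) {n : ℕ} :
    F.BluePath (m n) (m (n + 1)) ⊕ F.RedPath (m n) (m (n + 1)) →
      Set (F.BluePath (m (n + 1)) (m (n + 1 + 1)) ⊕ F.RedPath (m (n + 1)) (m (n + 1 + 1)))
  | Sum.inl _ => ∅
  | Sum.inr f => {x | ∃ g : F.RedPath (m (n + 1)) (m (n + 1 + 1)), x = Sum.inr g ∧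
      ∀ i (h : i + 1 = m (n + 1)),
        g.1.edge (i + 1) h.ge (h.trans_lt (hm (n + 1).lt_succ_self)) ∈
          F.R (f.1.edge i (Nat.le_of_lt_succ
            ((hm n.lt_succ_self).trans_eq h.symm)) (i.lt_succ_self.trans_eq h))}

/-- The contraction (telescoping) of `F` with respect to the sequence `m`. -/
def contract (m : ℕ → ℕ) (hm : StrictMono m) : ColoredDiagram.{u} where
  V n := F.V (m n)
  E n := F.BluePath (m n) (m (n + 1)) ⊕ F.RedPath (m n) (m (n + 1))
  r {n} e := (F.edgePath e).vert (m n) le_rfl (hm n.lt_succ_self).le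
  s {n} e := (F.edgePath e).vert (m (n + 1)) (hm n.lt_succ_self).le le_rfl
  D := colorSeparation
    (V := fun n => F.V (m n))
    (E := fun n => F.BluePath (m n) (m (n + 1)) ⊕ F.RedPath (m n) (m (n + 1)))
    (fun {n} e => (F.edgePath e).vert (m n) le_rfl (hm n.lt_succ_self).le)
    (fun {n} e => (F.edgePath e).vert (m (n + 1)) (hm n.lt_succ_self).le le_rfl)
    (Set.range Sum.inl) (F.contractR m hm)
  blue := Set.range Sum.inl
  R := F.contractR m hm

end ColoredDiagram

/-- The class of `l`-diagrams. -/
def LDiag : Type (u + 1) := {F : ColoredDiagram.{u} // F.IsLDiagram}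

/-- `G` is the contraction of `F` with respect to some admissible sequence. -/
def LDiag.Contracts (F G : LDiag.{u}) : Prop :=
  ∃ (m : ℕ → ℕ) (hm : ColoredDiagram.IsContractionSeq m), G.1 = F.1.contract m hm.1

/-- The equivalence relation on `l`-diagrams generated by isomorphism and contraction. -/
instance LDiag.setoid : Setoid LDiag.{u} :=
  Relation.EqvGen.setoid fun F G : LDiag.{u} => F.1.Iso G.1 ∨ F.Contracts G

/-! ### From systems to diagrams -/

section Partitions

variable {X : Type u}

/-- A finite family of non-empty, pairwise disjoint clopen sets covering `X`. -/
def IsClopenPartition [TopologicalSpace X] (P : Set (Set X)) : Prop :=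
  P.Finite ∧ (∀ Z ∈ P, IsClopen Z) ∧ IsSetPartition P Set.univ

/-- `Q` is finer than `P`. -/
def Coarser (P Q : Set (Set X)) : Prop := ∀ Z ∈ Q, ∃ Z' ∈ P, Z ⊆ Z'

/-- The non-empty intersections of a member of `P` with a member of `Q`. -/
def wedge (P Q : Set (Set X)) : Set (Set X) :=
  {W | W.Nonempty ∧ ∃ Z ∈ P, ∃ Z' ∈ Q, W = Z ∩ Z'}

/-- The points with at least `k` preimages. -/
def manyPreimages (σ : X → X) (k : ℕ) : Set X := {x | (k : ℕ∞) ≤ (σ ⁻¹' {x}).encard}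

/-- The family of the non-empty sets `σ(Z₁) ∩ ⋯ ∩ σ(Z_k)`, minus the points with more than `k`
preimages, for `k ≥ 1` distinct members `Z₁, …, Z_k` of `P`. -/
def imagePartition (σ : X → X) (P : Set (Set X)) : Set (Set X) :=
  {W | W.Nonempty ∧ ∃ T : Finset (Set X), T.Nonempty ∧ (T : Set (Set X)) ⊆ P ∧
    W = (⋂ Z ∈ T, σ '' Z) \ manyPreimages σ (T.card + 1)}

/-- The family of the preimages of the members of `P`. -/
def preimagePartition (σ : X → X) (P : Set (Set X)) : Set (Set X) := (fun Z => σ ⁻¹' Z) '' P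

/-- The maximal diameter of the members of a finite non-empty family. -/
noncomputable def partitionDiam (d : MetricSpace X) (P : Set (Set X)) : ℝ :=
  sSup (Metric.diam '' P)

/-- The `σ`-refined sequences of partitions of `X`. -/
structure IsRefinedSeq [t : TopologicalSpace X] (σ : X → X) (P : ℕ → Set (Set X)) : Prop where
  isPartition : ∀ n, IsClopenPartition (P n)
  restrict_homeo : ∀ Z ∈ P 0, Topology.IsEmbedding (Z.domRestrict σ)
  coarser : ∀ n, Coarser (P n) (P (n + 1))
  generates : t = TopologicalSpace.generateFrom (⋃ n, P n)
  diam : ∃ d : MetricSpace X, d.toUniformSpace.toTopologicalSpace = t ∧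
    Filter.Tendsto (fun n => partitionDiam d (P n)) Filter.atTop (nhds 0)
  refine_even : ∀ n, Even n → Coarser (wedge (P n) (imagePartition σ (P n))) (P (n + 1))
  refine_odd : ∀ n, Odd n → Coarser (wedge (P n) (preimagePartition σ (P n))) (P (n + 1))

/-- There is a red edge from `Z'` in layer `n + 1` to `Z` in layer `n`. -/
def RedRel (σ : X → X) (n : ℕ) (Z' Z : Set X) : Prop :=
  (Even n ∧ Z' ⊆ σ '' Z) ∨ (Odd n ∧ Z' ⊆ σ ⁻¹' Z)

/-- The edges of layer `n` of the diagram of a sequence of partitions: the blue ones (left) are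
the pairs `(Z', Z)` with `Z' ⊆ Z`, the red ones (right) those with `RedRel σ n Z' Z`. -/
def PartEdge (σ : X → X) (P : ℕ → Set (Set X)) (n : ℕ) : Type u :=
  {p : P (n + 1) × P n // (p.1 : Set X) ⊆ p.2} ⊕
    {p : P (n + 1) × P n // RedRel σ n (p.1 : Set X) p.2}

/-- The source and the range of an edge. -/
def PartEdge.ends {σ : X → X} {P : ℕ → Set (Set X)} {n : ℕ} :
    PartEdge σ P n → P (n + 1) × P n
  | Sum.inl p => p.1
  | Sum.inr p => p.1

/-- The blue edges. -/
def PartEdge.blue {σ : X → X} {P : ℕ → Set (Set X)} {n : ℕ} : Set (PartEdge σ P n) :=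
  Set.range Sum.inl

/-- The set `R f` of the red edges that end at the source of `f` and whose source is contained
in the range of `f`. -/
def PartEdge.R {σ : X → X} {P : ℕ → Set (Set X)} {n : ℕ} (f : PartEdge σ P n) :
    Set (PartEdge σ P (n + 1)) :=
  {g | g ∉ PartEdge.blue ∧ g.ends.2 = f.ends.1 ∧ (g.ends.1 : Set X) ⊆ f.ends.2}

/-- The diagram of a sequence of partitions. -/
def diagramOf (σ : X → X) (P : ℕ → Set (Set X)) : ColoredDiagram.{u} where
  V n := P n
  E n := PartEdge σ P n
  r e := e.ends.2
  s e := e.ends.1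
  D := ColoredDiagram.colorSeparation (V := fun n => P n) (E := fun n => PartEdge σ P n)
    (fun e => e.ends.2) (fun e => e.ends.1) PartEdge.blue PartEdge.R
  blue := PartEdge.blue
  R := PartEdge.R

end Partitions

/-! ### From diagrams to systems -/

namespace ColoredDiagram

variable (F : ColoredDiagram.{u})

/-- The infinite blue paths. -/
def PathSpace : Type u :=
  {x : ∀ n, F.E n // ∀ n, x n ∈ F.blue ∧ F.r (x (n + 1)) = F.s (x n)}

/-- The cylinder `Z(x₀, …, x_n)`. -/
def cylinder (x : F.PathSpace) (n : ℕ) : Set F.PathSpace := {y | ∀ i ≤ n, y.1 i = x.1 i}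

/-- The topology generated by the cylinders. -/
instance : TopologicalSpace F.PathSpace :=
  TopologicalSpace.generateFrom {U | ∃ x n, U = F.cylinder x n}

/-- The path `y` is the image of the path `x`: there are red edges `f₀, f₁, …` such that
`(x_n, x_{n+1}, f_n, f_{n+1})` is a romb with `f_{n+1} ∈ R(f_n)` for every even `n`, and
`(y_n, y_{n+1}, f_n, f_{n+1})` is a romb for every odd `n`. -/
def ShiftRel (x y : F.PathSpace) : Prop :=
  ∃ f : ∀ n, F.E n, (∀ n, f n ∈ F.red) ∧ (∀ n, F.s (f n) = F.r (f (n + 1))) ∧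
    (∀ n, Even n → F.r (f n) = F.r (x.1 n) ∧ F.s (f (n + 1)) = F.s (x.1 (n + 1)) ∧
      f (n + 1) ∈ F.R (f n)) ∧
    (∀ n, Odd n → F.r (y.1 n) = F.r (f n) ∧ F.s (y.1 (n + 1)) = F.s (f (n + 1)))

end ColoredDiagram

end LCorr

/-!
Both sides are compared through *labellings* of a system `(X, σ)`: sequences of locally constant
functions `p n : X → V n` whose fibres are the members of the `n`-th partition (`IsLabelling`).
A diagram with vertex sets `V n` is *represented* by the labelling (`Represents`) if all its
incidences are witnessed by points of `X`: there is a blue edge from `w` to `v` exactly if some `x`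
has `p (n + 1) x = w` and `p n x = v`, a red edge exactly if the same holds with `x` read at the
even layer and `σ x` at the odd layer, edges of one colour are determined by their ends, and `R f` is
given by the points that lie in the source of `g` and in the range of `f`.  The diagram of a
refined sequence is represented by its cells (`represents_diagramOf`), a represented diagram is an
`l`-diagram (`Represents.isLDiagram`) and is determined up to isomorphism by the fibres
(`Represents.iso`), and a contraction of a represented diagram is represented by the corresponding
subsequence of the labelling (`Represents.contract`).

For an `l`-diagram the blue edges form a forest, so that the path space is the inverse limit of the
finite vertex sets.  A red edge `f` of an even layer defines a clopen set of paths
(`redCylinder`); by the romb property (g) paths lift uniquely, and hence `σ_F` maps this set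
homeomorphically onto the set of paths through the source of `f`.  This gives the local
homeomorphism (`isLHomeo_shift`).  The labelling by vertices represents the diagram from the layer
`2` on (`represents_vert`); in layer `0` parallel red edges are possible, which is why `F` is
contracted before it is compared with the diagram of a refined sequence.

The map from systems to diagrams is well defined because the layers of two labellings of one
system can be interleaved: some labelling shares with each of the two a subsequence of alternating
parity, so that its diagram has a contraction in common, up to isomorphism, with each of the two
given diagrams (`LDiag.equiv_of_represents`).  The map from diagrams to systems is well defined because a compact system whose points are labelled
compatibly with the blue edges and the red edges of the odd layers is conjugate to the path
space (`exists_conj`).  This criterion applies to isomorphisms, to contractions, and to the diagram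
of a refined sequence, where it shows that one composition is the identity.  The other composition
is the identity because a contraction of `F` and the diagram of a refined sequence of `X_F` are
represented by labellings of the same system.
-/

namespace LCorr

theorem _root_.IsLocallyConstant.isClopen_preimage {A B : Type*} [TopologicalSpace A] {f : A → B}
    (hf : IsLocallyConstant f) (s : Set B) : IsClopen (f ⁻¹' s) :=
  ⟨⟨hf sᶜ⟩, hf s⟩

/-! ### The blue forest of an `l`-diagram -/

/-- In an inverse system with surjective maps every element lies on a coherent sequence. -/
theorem exists_coherent (n : ℕ) : ∀ {V : ℕ → Type u} (π : ∀ i, V (i + 1) → V i)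
    (_ : ∀ i, Function.Surjective (π i)) (v : V n),
    ∃ t : ∀ i, V i, (∀ i, π i (t (i + 1)) = t i) ∧ t n = v := by
  induction n with
  | zero =>
    intro V π hπ v
    choose c hc using hπ
    exact ⟨fun i => Nat.rec v (fun i w => c i w) i, fun i => hc i _, rfl⟩
  | succ n ih =>
    intro V π hπ v
    obtain ⟨t, ht, htn⟩ := ih (V := fun i => V (i + 1)) (fun i => π (i + 1)) (fun i => hπ _) v
    refine ⟨fun i => Nat.casesOn i (π 0 (t 0)) t, ?_, htn⟩
    rintro (_ | i)
    · rfl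
    · exact ht i

namespace ColoredDiagram

variable {F : ColoredDiagram.{u}}

namespace IsLDiagram

variable (hF : F.IsLDiagram)
include hF

theorem red_ext {n : ℕ} (hn : Odd n) {f f' : F.E n} (h : f ∈ F.red) (h' : f' ∈ F.red)
    (hs : F.s f = F.s f') : f = f' := by
  have hr : F.r f = F.r f' := by
    by_contra hne
    exact Set.disjoint_left.1 (hF.even_red_disjoint n hn hne) ⟨f, ⟨h, rfl⟩, rfl⟩
      ⟨f', ⟨h', rfl⟩, hs.symm⟩
  exact hF.even_red_inj n hn (F.r f) ⟨h, rfl⟩ ⟨h', hr.symm⟩ hs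

theorem exists_red {n : ℕ} (hn : Odd n) (w : F.V (n + 1)) : ∃ f : F.E n, f ∈ F.red ∧ F.s f = w := by
  have h : w ∈ ⋃ v : F.V n, F.s '' F.Rv v := hF.even_red n hn ▸ Set.mem_univ w
  obtain ⟨v, f, hf, rfl⟩ := Set.mem_iUnion.1 h
  exact ⟨f, hf.1, rfl⟩

theorem blue_ext {n : ℕ} {e e' : F.E n} (h : e ∈ F.blue) (h' : e' ∈ F.blue)
    (hs : F.s e = F.s e') : e = e' := by
  rcases Nat.even_or_odd n with hn | hn
  · exact hF.odd_blue_inj n hn h h' hs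
  · have hr : F.r e = F.r e' := by
      by_contra hne
      exact Set.disjoint_left.1 (hF.even_blue_disjoint n hn hne) ⟨e, ⟨h, rfl⟩, rfl⟩
        ⟨e', ⟨h', rfl⟩, hs.symm⟩
    exact hF.even_blue_inj n hn (F.r e) ⟨h, rfl⟩ ⟨h', hr.symm⟩ hs

/-- Every vertex of positive index is the source of a blue edge.  At the odd layers of index at
least `3` this is not an axiom: a vertex there is the source of some edge, and if that edge is
red, then the romb property of the preceding layer supplies a blue one. -/
theorem exists_blue : ∀ (n : ℕ) (w : F.V (n + 1)), ∃ e : F.E n, e ∈ F.blue ∧ F.s e = w := by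
  intro n w
  rcases Nat.even_or_odd n with hn | hn
  · rcases n with _ | n
    · have h : w ∈ ⋃ v : F.V 0, F.s '' F.B v := hF.first_blue ▸ Set.mem_univ w
      obtain ⟨v, f, hf, rfl⟩ := Set.mem_iUnion.1 h
      exact ⟨f, hf.1, rfl⟩
    · obtain ⟨e, rfl⟩ := hF.source_surjective (n + 1) w
      by_cases he : e ∈ F.blue
      · exact ⟨e, he, rfl⟩
      · have hn' : Odd n := by grind
        obtain ⟨f, hf, hfs⟩ := hF.exists_red hn' (F.r e)
        obtain ⟨p, ⟨-, h2, -, -, h5⟩, -⟩ := hF.romb_red n hn' f e hf he hfs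
        exact ⟨p.2, h2, h5⟩
  · have h : w ∈ ⋃ v : F.V n, F.s '' F.B v := hF.even_blue n hn ▸ Set.mem_univ w
    obtain ⟨v, f, hf, rfl⟩ := Set.mem_iUnion.1 h
    exact ⟨f, hf.1, rfl⟩

/-- The unique blue edge with a given source. -/
noncomputable def blueEdge {n : ℕ} (w : F.V (n + 1)) : F.E n := (hF.exists_blue n w).choose

theorem blueEdge_mem {n : ℕ} (w : F.V (n + 1)) : hF.blueEdge w ∈ F.blue :=
  (hF.exists_blue n w).choose_spec.1

theorem s_blueEdge {n : ℕ} (w : F.V (n + 1)) : F.s (hF.blueEdge w) = w :=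
  (hF.exists_blue n w).choose_spec.2

theorem eq_blueEdge {n : ℕ} {e : F.E n} (he : e ∈ F.blue) : e = hF.blueEdge (F.s e) :=
  hF.blue_ext he (hF.blueEdge_mem _) (hF.s_blueEdge _).symm

/-- The range of the unique blue edge with a given source: the blue edges form a forest, and this
is its parent map. -/
noncomputable def parent {n : ℕ} (w : F.V (n + 1)) : F.V n := F.r (hF.blueEdge w)

theorem parent_s {n : ℕ} {e : F.E n} (he : e ∈ F.blue) : hF.parent (F.s e) = F.r e := by
  rw [parent, ← hF.eq_blueEdge he]

theorem parent_surjective (n : ℕ) : Function.Surjective (hF.parent (n := n)) := by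
  intro v
  obtain ⟨e, he, rfl⟩ := hF.blue_nonempty n v
  exact ⟨F.s e, hF.parent_s he⟩

theorem mem_R {n : ℕ} (hn : Even n) {f : F.E n} (hf : f ∈ F.red) {g : F.E (n + 1)}
    (hg : g ∈ F.R f) : g ∈ F.red ∧ F.r g = F.s f := by
  have h : g ∈ F.Rv (F.s f) := by
    rw [hF.R_iUnion n hn]
    exact Set.mem_biUnion (x := f) ⟨hf, rfl⟩ hg
  exact h

theorem exists_mem_R {n : ℕ} (hn : Even n) {g : F.E (n + 1)} (hg : g ∈ F.red) :
    ∃ f : F.E n, f ∈ F.red ∧ F.s f = F.r g ∧ g ∈ F.R f := by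
  have h : g ∈ F.Rv (F.r g) := ⟨hg, rfl⟩
  rw [hF.R_iUnion n hn] at h
  obtain ⟨f, hf, hgf⟩ := Set.mem_iUnion₂.1 h
  exact ⟨f, hf.1, hf.2, hgf⟩

/-- The inclusion of the right-hand side of (e) in the left-hand side. -/
theorem parent_parent_of_mem_R {n : ℕ} (hn : Even n) {f : F.E n} (hf : f ∈ F.red)
    {g : F.E (n + 1)} (hg : g ∈ F.R f) : hF.parent (hF.parent (F.s g)) = F.r f := by
  have h : F.s g ∈ ⋃ e ∈ F.B (F.r f), F.s '' F.B (F.s e) := by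
    rw [hF.compat n hn]
    exact Set.mem_biUnion (x := f) ⟨hf, rfl⟩ ⟨g, hg, rfl⟩
  obtain ⟨e, he, e', he', h⟩ := Set.mem_iUnion₂.1 h
  rw [← h, hF.parent_s he'.1, he'.2, hF.parent_s he.1, he.2]

/-- The inclusion of the left-hand side of (e) in the right-hand side. -/
theorem exists_red_pair {n : ℕ} (hn : Even n) (w : F.V (n + 2)) :
    ∃ f : F.E n, f ∈ F.red ∧ F.r f = hF.parent (hF.parent w) ∧ ∃ g ∈ F.R f, F.s g = w := by
  have h : w ∈ ⋃ e ∈ F.B (hF.parent (hF.parent w)), F.s '' F.B (F.s e) :=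
    Set.mem_biUnion (x := hF.blueEdge (hF.parent w)) ⟨hF.blueEdge_mem _, rfl⟩
      ⟨hF.blueEdge w, ⟨hF.blueEdge_mem _, (hF.s_blueEdge _).symm⟩, hF.s_blueEdge _⟩
  rw [hF.compat n hn] at h
  obtain ⟨f, hf, g, hg, h⟩ := Set.mem_iUnion₂.1 h
  exact ⟨f, hf.1, hf.2, g, hg, h⟩

theorem parent_parent_red {n : ℕ} (hn : Odd n) {f : F.E n} {f' : F.E (n + 1)} (hf : f ∈ F.red)
    (hf' : f' ∈ F.red) (h : F.s f = F.r f') : hF.parent (hF.parent (F.s f')) = F.r f := by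
  obtain ⟨p, ⟨h1, h2, h3, h4, h5⟩, -⟩ := hF.romb_red n hn f f' hf hf' h
  rw [← h5, hF.parent_s h2, ← h4, hF.parent_s h1, h3]

/-- The romb property (g) in terms of the parent map. -/
theorem romb_parent {n : ℕ} (hn : Even n) {g : F.E n} (hg : g ∈ F.red) {t : F.V (n + 3)}
    (ht : hF.parent (hF.parent t) = F.s g) :
    ∃! f : F.E (n + 1) × F.E (n + 2), f.1 ∈ F.red ∧ f.2 ∈ F.red ∧ f.1 ∈ F.R g ∧
      F.s f.1 = F.r f.2 ∧ F.s f.2 = t := by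
  obtain ⟨p, ⟨h1, h2, h3, h4, h5, h6⟩, hu⟩ := hF.romb_blue n hn g (hF.blueEdge (hF.parent t))
    (hF.blueEdge t) hg (hF.blueEdge_mem _) (hF.blueEdge_mem _) ht (hF.s_blueEdge _)
  refine ⟨p, ⟨h1, h2, h3, h5, h6.trans (hF.s_blueEdge _)⟩, ?_⟩
  rintro q ⟨k1, k2, k3, k5, k6⟩
  exact hu q ⟨k1, k2, k3, (hF.mem_R hn hg k3).2.trans ht.symm, k5, k6.trans (hF.s_blueEdge _).symm⟩

/-- Only the first layer may have several red edges with the same range and the same source. -/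
theorem red_ext_of_even {n : ℕ} (hn : Even n) {f f' : F.E (n + 2)} (h : f ∈ F.red)
    (h' : f' ∈ F.red) (hs : F.s f = F.s f') (hr : F.r f = F.r f') : f = f' := by
  obtain ⟨f₀, hf₀, hfs⟩ := hF.exists_red hn.add_one (F.r f)
  obtain ⟨g, hg, hgs, hfg⟩ := hF.exists_mem_R hn hf₀
  have ht : hF.parent (hF.parent (F.s f)) = F.s g := by
    rw [hF.parent_parent_red hn.add_one hf₀ h hfs, hgs]
  have := (hF.romb_parent hn hg ht).unique (y₁ := (f₀, f)) (y₂ := (f₀, f'))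
    ⟨hf₀, h, hfg, hfs, rfl⟩ ⟨hf₀, h', hfg, hfs.trans hr, hs.symm⟩
  exact (Prod.ext_iff.1 this).2

end IsLDiagram

/-! ### The path space -/

/-- The vertex of layer `n` of an infinite blue path. -/
def vert (n : ℕ) (x : F.PathSpace) : F.V n := F.r (x.1 n)

theorem s_eq_vert (n : ℕ) (x : F.PathSpace) : F.s (x.1 n) = vert (n + 1) x := (x.2 n).2.symm

namespace IsLDiagram

variable (hF : F.IsLDiagram)
include hF

theorem parent_vert (n : ℕ) (x : F.PathSpace) : hF.parent (vert (n + 1) x) = vert n x := by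
  rw [← s_eq_vert, hF.parent_s (x.2 n).1, vert]

theorem path_eq_blueEdge (n : ℕ) (x : F.PathSpace) : x.1 n = hF.blueEdge (vert (n + 1) x) := by
  rw [← s_eq_vert, ← hF.eq_blueEdge (x.2 n).1]

theorem vert_eq_of_le {x y : F.PathSpace} {m n : ℕ} (hmn : m ≤ n) (h : vert n x = vert n y) :
    vert m x = vert m y := by
  induction n, hmn using Nat.le_induction with
  | base => exact h
  | succ n _ ih => exact ih (by rw [← hF.parent_vert n, h, hF.parent_vert])

/-- A path is determined by infinitely many of its vertices. -/
theorem path_ext {x y : F.PathSpace} (h : ∀ N, ∃ n, N ≤ n ∧ vert n x = vert n y) : x = y := by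
  apply Subtype.ext
  funext n
  obtain ⟨m, hm, hxy⟩ := h (n + 1)
  rw [hF.path_eq_blueEdge, hF.path_eq_blueEdge n y, hF.vert_eq_of_le hm hxy]

/-- The path through a coherent sequence of vertices. -/
noncomputable def mkPath (t : ∀ n, F.V n) (ht : ∀ n, hF.parent (t (n + 1)) = t n) : F.PathSpace :=
  ⟨fun n => hF.blueEdge (t (n + 1)), fun n => ⟨hF.blueEdge_mem _, by
    rw [hF.s_blueEdge]
    exact ht (n + 1)⟩⟩

theorem vert_mkPath (t : ∀ n, F.V n) (ht : ∀ n, hF.parent (t (n + 1)) = t n) (n : ℕ) :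
    vert n (hF.mkPath t ht) = t n := ht n

theorem vert_surjective (n : ℕ) : Function.Surjective (vert (F := F) n) := by
  intro v
  obtain ⟨t, ht, rfl⟩ := exists_coherent n (fun _ => hF.parent) hF.parent_surjective v
  exact ⟨hF.mkPath t ht, hF.vert_mkPath t ht n⟩

theorem cylinder_eq (x : F.PathSpace) (n : ℕ) :
    F.cylinder x n = vert (n + 1) ⁻¹' {vert (n + 1) x} := by
  ext y
  constructor
  · intro h
    have := h n le_rfl
    simp only [Set.mem_preimage, Set.mem_singleton_iff]
    rw [← s_eq_vert, ← s_eq_vert, this]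
  · intro h i hi
    rw [hF.path_eq_blueEdge, hF.path_eq_blueEdge i x,
      hF.vert_eq_of_le (Nat.succ_le_succ hi) (Set.mem_singleton_iff.1 h)]

omit hF in
theorem isOpen_vert (n : ℕ) (v : F.V n) : IsOpen (vert (F := F) n ⁻¹' {v}) := by
  have : vert (F := F) n ⁻¹' {v} = ⋃ x ∈ {x : F.PathSpace | vert n x = v}, F.cylinder x n := by
    ext y
    simp only [Set.mem_preimage, Set.mem_singleton_iff, Set.mem_iUnion, Set.mem_ofPred_eq]
    constructor
    · intro h
      exact ⟨y, h, fun _ _ => rfl⟩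
    · rintro ⟨x, hx, hy⟩
      rw [← hx, vert, vert, hy n le_rfl]
  rw [this]
  exact isOpen_biUnion fun x _ => TopologicalSpace.isOpen_generateFrom_of_mem ⟨x, n, rfl⟩

omit hF in
theorem isLocallyConstant_vert (n : ℕ) : IsLocallyConstant (vert (F := F) n) :=
  (IsLocallyConstant.iff_isOpen_fiber).2 fun v => isOpen_vert n v

theorem continuous_of_vert {A : Type*} [TopologicalSpace A] {φ : A → F.PathSpace}
    (h : ∀ n, IsLocallyConstant fun a => vert n (φ a)) : Continuous φ := by
  refine continuous_generateFrom_iff.2 ?_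
  rintro _ ⟨x, n, rfl⟩
  rw [hF.cylinder_eq]
  exact h (n + 1) _

/-- The path space is homeomorphic to the inverse limit of the finite vertex sets. -/
theorem topology_props : Nonempty F.PathSpace ∧ CompactSpace F.PathSpace ∧
    TopologicalSpace.MetrizableSpace F.PathSpace ∧ TotallyDisconnectedSpace F.PathSpace := by
  let _ : ∀ n, TopologicalSpace (F.V n) := fun _ => ⊥
  have : ∀ n, DiscreteTopology (F.V n) := fun _ => ⟨rfl⟩
  have : ∀ n, Finite (F.V n) := hF.finite_V
  let ι : F.PathSpace → ∀ n, F.V n := fun x n => vert n x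
  have hcont : Continuous ι := continuous_pi fun n => (isLocallyConstant_vert n).continuous
  have hind : Topology.IsInducing ι := by
    constructor
    refine le_antisymm (continuous_iff_le_induced.1 hcont) (le_generateFrom ?_)
    rintro _ ⟨x, n, rfl⟩
    rw [hF.cylinder_eq]
    exact ⟨{t | t (n + 1) = vert (n + 1) x},
      (isOpen_discrete {vert (n + 1) x}).preimage (continuous_apply (n + 1)), rfl⟩
  have hinj : Function.Injective ι := fun x y h => hF.path_ext fun n => ⟨n, le_rfl, congrFun h n⟩
  have hrange : Set.range ι = ⋂ n, {t | hF.parent (t (n + 1)) = t n} := by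
    ext t
    simp only [Set.mem_range, Set.mem_iInter, Set.mem_ofPred_eq]
    constructor
    · rintro ⟨x, rfl⟩ n
      exact hF.parent_vert n x
    · intro h
      exact ⟨hF.mkPath t h, funext fun n => hF.vert_mkPath t h n⟩
  have hemb : Topology.IsClosedEmbedding ι := by
    refine ⟨⟨hind, hinj⟩, ?_⟩
    rw [hrange]
    exact isClosed_iInter fun n => isClosed_eq
      ((continuous_of_discreteTopology (f := hF.parent (n := n))).comp (continuous_apply _))
      (continuous_apply _)
  refine ⟨?_, hemb.compactSpace, hemb.isEmbedding.metrizableSpace, ?_⟩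
  · obtain ⟨v⟩ := hF.nonempty_V 0
    exact ⟨(hF.vert_surjective 0 v).choose⟩
  · exact ⟨fun s _ hs => fun x hx y hy => hinj
      ((hs.image ι hcont.continuousOn).subsingleton (Set.mem_image_of_mem ι hx)
        (Set.mem_image_of_mem ι hy))⟩

/-! ### The map on the path space -/

/-- The map on the path space in terms of vertices: the vertices of odd index of the image of `x`
are the ranges of the red edges that start at the vertices of `x`. -/
theorem shiftRel_iff (x y : F.PathSpace) : F.ShiftRel x y ↔
    ∀ n, Odd n → ∃ f : F.E n, f ∈ F.red ∧ F.s f = vert (n + 1) x ∧ F.r f = vert n y := by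
  constructor
  · rintro ⟨f, h1, -, h3, h4⟩ n hn
    refine ⟨f n, h1 n, ?_, (h4 n hn).1.symm⟩
    obtain ⟨k, rfl⟩ := hn
    rw [(h3 (2 * k) ⟨k, by ring⟩).2.1, s_eq_vert]
  · intro h
    -- At the odd layers the edges are determined by `x`, at the even layers they are given by (e).
    have key : ∀ n, ∃ f : F.E n, f ∈ F.red ∧
        (Odd n → F.s f = vert (n + 1) x ∧ F.r f = vert n y) ∧
        (Even n → F.r f = vert n x ∧ ∃ g ∈ F.R f, F.s g = vert (n + 2) x) := by
      intro n
      rcases Nat.even_or_odd n with hn | hn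
      · obtain ⟨f, hf, hfr, g, hg, hgs⟩ := hF.exists_red_pair hn (vert (n + 2) x)
        rw [hF.parent_vert, hF.parent_vert] at hfr
        exact ⟨f, hf, fun h' => absurd hn (Nat.not_even_iff_odd.2 h'), fun _ => ⟨hfr, g, hg, hgs⟩⟩
      · obtain ⟨f, hf, hfs⟩ := h n hn
        exact ⟨f, hf, fun _ => hfs, fun h' => absurd h' (Nat.not_even_iff_odd.2 hn)⟩
    choose f hred hodd heven using key
    have hR : ∀ n, Even n → f (n + 1) ∈ F.R (f n) := by
      intro n hn
      obtain ⟨g, hg, hgs⟩ := (heven n hn).2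
      have : f (n + 1) = g := hF.red_ext hn.add_one (hred _) (hF.mem_R hn (hred n) hg).1
        (by rw [(hodd _ hn.add_one).1, hgs])
      rwa [this]
    have hsr : ∀ n, F.s (f n) = F.r (f (n + 1)) := by
      intro n
      rcases Nat.even_or_odd n with hn | hn
      · exact (hF.mem_R hn (hred n) (hR n hn)).2.symm
      · rw [(hodd n hn).1, (heven _ hn.add_one).1]
    refine ⟨f, hred, hsr, fun n hn => ⟨(heven n hn).1, ?_, hR n hn⟩, fun n hn => ⟨?_, ?_⟩⟩
    · rw [(hodd _ hn.add_one).1, s_eq_vert]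
    · exact (hodd n hn).2.symm
    · rw [hsr, (hodd (n + 2) (by grind)).2, s_eq_vert]

theorem existsUnique_shiftRel (x : F.PathSpace) : ∃! y, F.ShiftRel x y := by
  have key : ∀ n, ∃ v : F.V n, Odd n → ∃ f : F.E n, f ∈ F.red ∧ F.s f = vert (n + 1) x ∧
      F.r f = v := by
    intro n
    by_cases hn : Odd n
    · obtain ⟨f, hf, hfs⟩ := hF.exists_red hn (vert (n + 1) x)
      exact ⟨F.r f, fun _ => ⟨f, hf, hfs, rfl⟩⟩
    · obtain ⟨v⟩ := hF.nonempty_V n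
      exact ⟨v, fun h => absurd h hn⟩
  choose v hv using key
  have hpp : ∀ n, Odd n → hF.parent (hF.parent (v (n + 2))) = v n := by
    intro n hn
    obtain ⟨f, hf, hfs, hfr⟩ := hv n hn
    obtain ⟨f', hf', hfs', hfr'⟩ := hv (n + 2) (by grind)
    obtain ⟨g, hg, hgs, hgf⟩ := hF.exists_mem_R (n := n + 1) (by grind) hf'
    have hgr := hF.parent_parent_of_mem_R (by grind) hg hgf
    rw [hfs', hF.parent_vert, hF.parent_vert] at hgr
    rw [← hfr, ← hF.parent_parent_red hn hf hg (hfs.trans hgr), ← hfr', hgs]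
  -- The vertices of even index are the parents of those of odd index.
  let t : ∀ n, F.V n := fun n => if Odd n then v n else hF.parent (v (n + 1))
  have ht : ∀ n, hF.parent (t (n + 1)) = t n := by
    intro n
    rcases Nat.even_or_odd n with hn | hn
    · have h1 : t (n + 1) = v (n + 1) := if_pos hn.add_one
      have h2 : t n = hF.parent (v (n + 1)) := if_neg (Nat.not_odd_iff_even.2 hn)
      rw [h1, h2]
    · have h1 : t (n + 1) = hF.parent (v (n + 2)) := if_neg (Nat.not_odd_iff_even.2 hn.add_one)
      have h2 : t n = v n := if_pos hn
      rw [h1, h2, hpp n hn]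
  refine ⟨hF.mkPath t ht, (hF.shiftRel_iff _ _).2 fun n hn => ?_, fun y hy => ?_⟩
  · rw [hF.vert_mkPath, show t n = v n from if_pos hn]
    exact hv n hn
  · refine hF.path_ext fun N => ⟨2 * N + 1, by omega, ?_⟩
    have hn : Odd (2 * N + 1) := ⟨N, rfl⟩
    obtain ⟨f, hf, hfs, hfr⟩ := (hF.shiftRel_iff _ _).1 hy _ hn
    obtain ⟨f', hf', hfs', hfr'⟩ := hv _ hn
    rw [hF.vert_mkPath, show t (2 * N + 1) = v (2 * N + 1) from if_pos hn, ← hfr, ← hfr',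
      hF.red_ext hn hf hf' (hfs.trans hfs'.symm)]

/-- The map `σ_F` on the path space. -/
noncomputable def shift (x : F.PathSpace) : F.PathSpace := (hF.existsUnique_shiftRel x).choose

theorem shiftRel_iff_shift (x y : F.PathSpace) : F.ShiftRel x y ↔ hF.shift x = y := by
  have h := (hF.existsUnique_shiftRel x).choose_spec
  exact ⟨fun hy => (h.2 y hy).symm, fun hy => hy ▸ h.1⟩

theorem exists_red_shift_odd {n : ℕ} (hn : Odd n) (x : F.PathSpace) :
    ∃ f : F.E n, f ∈ F.red ∧ F.s f = vert (n + 1) x ∧ F.r f = vert n (hF.shift x) :=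
  (hF.shiftRel_iff _ _).1 ((hF.shiftRel_iff_shift _ _).2 rfl) n hn

theorem r_of_red_odd {n : ℕ} (hn : Odd n) {f : F.E n} (hf : f ∈ F.red) {x : F.PathSpace}
    (hfs : F.s f = vert (n + 1) x) : F.r f = vert n (hF.shift x) := by
  obtain ⟨f', hf', hfs', hfr'⟩ := hF.exists_red_shift_odd hn x
  rw [← hfr', hF.red_ext hn hf hf' (hfs.trans hfs'.symm)]

/-- The set of paths `x` for which `f` is the red edge of its (even) layer in the definition of
`ShiftRel`. -/
def redCylinder {n : ℕ} (f : F.E n) : Set F.PathSpace := {x | ∃ g ∈ F.R f, F.s g = vert (n + 2) x}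

omit hF in
theorem redCylinder_eq {n : ℕ} (f : F.E n) :
    redCylinder f = vert (n + 2) ⁻¹' (F.s '' F.R f) := rfl

theorem vert_of_mem_redCylinder {n : ℕ} (hn : Even n) {f : F.E n} (hf : f ∈ F.red)
    {x : F.PathSpace} (hx : x ∈ redCylinder f) : vert n x = F.r f := by
  obtain ⟨g, hg, hgs⟩ := hx
  rw [← hF.parent_parent_of_mem_R hn hf hg, hgs, hF.parent_vert, hF.parent_vert]

theorem vert_shift_of_mem_redCylinder {n : ℕ} (hn : Even n) {f : F.E n} (hf : f ∈ F.red)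
    {x : F.PathSpace} (hx : x ∈ redCylinder f) : vert (n + 1) (hF.shift x) = F.s f := by
  obtain ⟨g, hg, hgs⟩ := hx
  obtain ⟨h1, h2⟩ := hF.mem_R hn hf hg
  rw [← h2, hF.r_of_red_odd hn.add_one h1 hgs]

theorem exists_redCylinder {n : ℕ} (hn : Even n) (x : F.PathSpace) :
    ∃ f : F.E n, f ∈ F.red ∧ x ∈ redCylinder f := by
  obtain ⟨f, hf, -, hg⟩ := hF.exists_red_pair hn (vert (n + 2) x)
  exact ⟨f, hf, hg⟩

theorem exists_red_pair_of_mem {n : ℕ} (hn : Even n) {f : F.E n} (hf : f ∈ F.red)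
    {y : F.PathSpace} (hy : vert (n + 1) y = F.s f) :
    ∃! q : F.E (n + 1) × F.E (n + 2), q.1 ∈ F.red ∧ q.2 ∈ F.red ∧ q.1 ∈ F.R f ∧
      F.s q.1 = F.r q.2 ∧ F.s q.2 = vert (n + 3) y :=
  hF.romb_parent hn hf (by rw [hF.parent_vert, hF.parent_vert, hy])

theorem exists_common_redCylinder {n : ℕ} (hn : Even n) {f : F.E n} (hf : f ∈ F.red)
    {x x' : F.PathSpace} (hx : x ∈ redCylinder f) (hx' : x' ∈ redCylinder f)
    (h : hF.shift x = hF.shift x') :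
    ∃ f' : F.E (n + 2), f' ∈ F.red ∧ x ∈ redCylinder f' ∧ x' ∈ redCylinder f' := by
  obtain ⟨g, hg, hgs⟩ := id hx
  obtain ⟨g', hg', hgs'⟩ := id hx'
  have hn2 : Even (n + 2) := by grind
  obtain ⟨f₂, hf₂, hxf⟩ := hF.exists_redCylinder hn2 x
  obtain ⟨f₂', hf₂', hxf'⟩ := hF.exists_redCylinder hn2 x'
  have := (hF.exists_red_pair_of_mem hn hf (hF.vert_shift_of_mem_redCylinder hn hf hx)).unique
    (y₁ := (g, f₂)) (y₂ := (g', f₂'))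
    ⟨(hF.mem_R hn hf hg).1, hf₂, hg, by rw [hgs, hF.vert_of_mem_redCylinder hn2 hf₂ hxf],
      (hF.vert_shift_of_mem_redCylinder hn2 hf₂ hxf).symm⟩
    ⟨(hF.mem_R hn hf hg').1, hf₂', hg', by rw [hgs', hF.vert_of_mem_redCylinder hn2 hf₂' hxf'],
      by rw [h]; exact (hF.vert_shift_of_mem_redCylinder hn2 hf₂' hxf').symm⟩
  have h2 : f₂ = f₂' := (Prod.ext_iff.1 this).2
  exact ⟨f₂, hf₂, hxf, h2 ▸ hxf'⟩

theorem shift_injOn {n : ℕ} (hn : Even n) {f : F.E n} (hf : f ∈ F.red) :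
    Set.InjOn hF.shift (redCylinder f) := by
  intro x hx x' hx' h
  have key : ∀ k : ℕ, ∃ f : F.E (n + 2 * k), f ∈ F.red ∧ x ∈ redCylinder f ∧
      x' ∈ redCylinder f := by
    intro k
    induction k with
    | zero => exact ⟨f, hf, hx, hx'⟩
    | succ k ih =>
      obtain ⟨f', hf', h1, h2⟩ := ih
      exact hF.exists_common_redCylinder (by grind) hf' h1 h2 h
  refine hF.path_ext fun N => ⟨n + 2 * N, by omega, ?_⟩
  obtain ⟨f', hf', h1, h2⟩ := key N
  rw [hF.vert_of_mem_redCylinder (by grind) hf' h1, hF.vert_of_mem_redCylinder (by grind) hf' h2]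

/-- Any finite part of a path through the source of a red edge `f` lifts to the red cylinder
of `f`. -/
theorem exists_lift (k : ℕ) : ∀ {n : ℕ} (_ : Even n) {f : F.E n} (_ : f ∈ F.red)
    {y : F.PathSpace} (_ : vert (n + 1) y = F.s f),
    ∃ x ∈ redCylinder f, vert (n + 1 + 2 * k) (hF.shift x) = vert (n + 1 + 2 * k) y := by
  induction k with
  | zero =>
    intro n hn f hf y hy
    obtain ⟨g, hg⟩ := hF.R_nonempty n hn f hf
    obtain ⟨x, hx⟩ := hF.vert_surjective (n + 2) (F.s g)
    have hxf : x ∈ redCylinder f := ⟨g, hg, hx.symm⟩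
    exact ⟨x, hxf, (hF.vert_shift_of_mem_redCylinder hn hf hxf).trans hy.symm⟩
  | succ k ih =>
    intro n hn f hf y hy
    obtain ⟨⟨g, f'⟩, ⟨-, h2, h3, h4, h5⟩, -⟩ := hF.exists_red_pair_of_mem hn hf hy
    obtain ⟨x, hx, hxy⟩ := ih (n := n + 2) (by grind) h2 h5.symm
    refine ⟨x, ⟨g, h3, ?_⟩, ?_⟩
    · rw [hF.vert_of_mem_redCylinder (by grind) h2 hx, h4]
    · have e : n + 1 + 2 * (k + 1) = n + 2 + 1 + 2 * k := by ring
      rw [e]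
      exact hxy

theorem continuous_shift : Continuous hF.shift := by
  refine hF.continuous_of_vert fun n => ?_
  obtain ⟨m, hnm, hm⟩ : ∃ m, n ≤ m ∧ Odd m := ⟨2 * n + 1, by omega, ⟨n, rfl⟩⟩
  rw [IsLocallyConstant.iff_eventually_eq]
  intro x
  filter_upwards [(IsLocallyConstant.iff_eventually_eq _).1 (isLocallyConstant_vert (m + 1)) x]
    with y hy
  obtain ⟨f, hf, hfs, hfr⟩ := hF.exists_red_shift_odd hm y
  exact hF.vert_eq_of_le hnm (by rw [← hfr, hF.r_of_red_odd hm hf (hfs.trans hy)])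

omit hF in
theorem isClopen_redCylinder {n : ℕ} (f : F.E n) : IsClopen (redCylinder f) := by
  rw [redCylinder_eq]
  exact (isLocallyConstant_vert (n + 2)).isClopen_preimage _

theorem image_redCylinder {n : ℕ} (hn : Even n) {f : F.E n} (hf : f ∈ F.red) :
    hF.shift '' redCylinder f = vert (n + 1) ⁻¹' {F.s f} := by
  apply Set.Subset.antisymm
  · rintro _ ⟨x, hx, rfl⟩
    exact hF.vert_shift_of_mem_redCylinder hn hf hx
  · intro y hy
    have := hF.topology_props.2.1
    -- The paths over finite parts of `y` form a decreasing sequence of non-empty compact sets.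
    let K : ℕ → Set F.PathSpace := fun k =>
      redCylinder f ∩ hF.shift ⁻¹' (vert (n + 1 + 2 * k) ⁻¹' {vert (n + 1 + 2 * k) y})
    have hK : ∀ k, IsClosed (K k) := fun k => (isClopen_redCylinder f).isClosed.inter
      (((isLocallyConstant_vert _).isClopen_preimage _).isClosed.preimage hF.continuous_shift)
    obtain ⟨x, hx⟩ := IsCompact.nonempty_iInter_of_sequence_nonempty_isCompact_isClosed K
      (fun k x hx => ⟨hx.1, hF.vert_eq_of_le (by omega) hx.2⟩)
      (fun k => by
        obtain ⟨x, hx, hxy⟩ := hF.exists_lift k hn hf hy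
        exact ⟨x, hx, hxy⟩) (hK 0).isCompact hK
    rw [Set.mem_iInter] at hx
    exact ⟨x, (hx 0).1, hF.path_ext fun N => ⟨n + 1 + 2 * N, by omega, (hx N).2⟩⟩

theorem isLHomeo_shift : IsLHomeo hF.shift := by
  obtain ⟨h1, h2, h3, h4⟩ := hF.topology_props
  refine ⟨h1, h2, h3, h4, isLocalHomeomorph_iff_isOpenEmbedding_restrict.2 fun x => ?_, fun y => ?_⟩
  · obtain ⟨f, hf, hx⟩ := hF.exists_redCylinder (n := 0) ⟨0, rfl⟩ x
    have hc := isClopen_redCylinder f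
    have : CompactSpace (redCylinder f) := isCompact_iff_compactSpace.1 hc.isClosed.isCompact
    refine ⟨redCylinder f, hc.isOpen.mem_nhds hx, ?_⟩
    have hemb := (hF.continuous_shift.comp continuous_subtype_val).isClosedEmbedding
      (Set.injOn_iff_injective.1 (hF.shift_injOn (n := 0) ⟨0, rfl⟩ hf))
    refine ⟨hemb.isEmbedding, ?_⟩
    rw [Set.range_domRestrict, hF.image_redCylinder ⟨0, rfl⟩ hf]
    exact isOpen_vert _ _
  · have h : vert 1 y ∈ ⋃ v : F.V 0, F.s '' F.Rv v := hF.first_red ▸ Set.mem_univ _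
    obtain ⟨v, f, hf, hfs⟩ := Set.mem_iUnion.1 h
    have hy : y ∈ hF.shift '' redCylinder f := by
      rw [hF.image_redCylinder ⟨0, rfl⟩ hf.1]
      exact hfs.symm
    obtain ⟨x, -, hx⟩ := hy
    exact ⟨x, hx⟩

/-! ### Recognizing the path space -/

/-- A system whose points are labelled compatibly with the blue edges and with the red edges of
the odd layers is conjugate to the path space. -/
theorem exists_conj {X : Type u} [TopologicalSpace X] [CompactSpace X] (σ : X → X)
    (p : ∀ n, X → F.V n) (hloc : ∀ n, IsLocallyConstant (p n))
    (hsurj : ∀ n, Function.Surjective (p n))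
    (hsep : ∀ x y, (∀ n, p n x = p n y) → x = y)
    (hblue : ∀ n x, ∃ e : F.E n, e ∈ F.blue ∧ F.s e = p (n + 1) x ∧ F.r e = p n x)
    (hred : ∀ n, Odd n → ∀ x, ∃ f : F.E n, f ∈ F.red ∧ F.s f = p (n + 1) x ∧
      F.r f = p n (σ x)) :
    ∃ h : X ≃ₜ F.PathSpace, ∀ x, h (σ x) = hF.shift (h x) := by
  obtain ⟨h1, h2, h3, h4⟩ := hF.topology_props
  have hpar : ∀ n x, hF.parent (p (n + 1) x) = p n x := by
    intro n x
    obtain ⟨e, he, hs, hr⟩ := hblue n x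
    rw [← hs, hF.parent_s he, hr]
  let φ : X → F.PathSpace := fun x => hF.mkPath (fun n => p n x) (fun n => hpar n x)
  have hφ : ∀ n x, vert n (φ x) = p n x := fun n x => hF.vert_mkPath _ _ n
  have hcont : Continuous φ := hF.continuous_of_vert fun n => by
    simp only [hφ]
    exact hloc n
  have hinj : Function.Injective φ := by
    intro x y h
    refine hsep x y fun n => ?_
    rw [← hφ, h, hφ]
  have hsur : Function.Surjective φ := by
    intro y
    have hK : ∀ n, IsClosed (p n ⁻¹' {vert n y}) := fun n =>
      ((hloc n).isClopen_preimage _).isClosed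
    obtain ⟨x, hx⟩ := IsCompact.nonempty_iInter_of_sequence_nonempty_isCompact_isClosed
      (fun n => p n ⁻¹' {vert n y})
      (fun n x hx => by
        have hx' : p (n + 1) x = vert (n + 1) y := hx
        change p n x = vert n y
        rw [← hpar, hx', hF.parent_vert])
      (fun n => by
        obtain ⟨x, hx⟩ := hsurj n (vert n y)
        exact ⟨x, hx⟩) (hK 0).isCompact hK
    rw [Set.mem_iInter] at hx
    exact ⟨x, hF.path_ext fun N => ⟨N, le_rfl, (hφ N x).trans (hx N)⟩⟩
  let h := hcont.homeoOfEquivCompactToT2 (f := Equiv.ofBijective φ ⟨hinj, hsur⟩)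
  refine ⟨h, fun x => ?_⟩
  change φ (σ x) = hF.shift (φ x)
  refine hF.path_ext fun N => ⟨2 * N + 1, by omega, ?_⟩
  obtain ⟨f, hf, hs, hr⟩ := hred (2 * N + 1) ⟨N, rfl⟩ x
  rw [hφ, ← hr, hF.r_of_red_odd ⟨N, rfl⟩ hf (hs.trans (hφ _ _).symm)]

end IsLDiagram
end ColoredDiagram

/-! ### Labellings of a system -/

/-- The point from which the vertex of layer `n` on a red path is read off: `x` at the even layers
and `σ x` at the odd layers. -/
def alternate {X : Type*} (σ : X → X) (x : X) (n : ℕ) : X := if Even n then x else σ x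

theorem alternate_even {X : Type*} (σ : X → X) (x : X) {n : ℕ} (hn : Even n) :
    alternate σ x n = x := if_pos hn

theorem alternate_odd {X : Type*} (σ : X → X) (x : X) {n : ℕ} (hn : Odd n) :
    alternate σ x n = σ x := if_neg (Nat.not_even_iff_odd.2 hn)

/-- A sequence of refining clopen partitions, encoded by locally constant functions `p n` whose
fibres are the members of the `n`-th partition.  The conditions that link the partitions to `σ`
are those of a `σ`-refined sequence, imposed from the layer `k` on only: at an even layer each
member of the next partition is contained in or disjoint from the image of each member (`even`), at
an odd layer it is contained in the preimage of a member (`odd`). -/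
structure IsLabelling {X : Type*} [TopologicalSpace X] (σ : X → X) (k : ℕ) {V : ℕ → Type*}
    (p : ∀ n, X → V n) : Prop where
  locConst : ∀ n, IsLocallyConstant (p n)
  coarser : ∀ n x y, p (n + 1) x = p (n + 1) y → p n x = p n y
  inj : ∀ x y, p k x = p k y → σ x = σ y → x = y
  even : ∀ n, k ≤ n → Even n → ∀ x y, p (n + 1) (σ x) = p (n + 1) y →
    ∃ x', σ x' = y ∧ p n x' = p n x
  odd : ∀ n, k ≤ n → Odd n → ∀ x y, p (n + 1) x = p (n + 1) y → p n (σ x) = p n (σ y)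
  separates : ∀ x y, (∀ n, p n x = p n y) → x = y

namespace IsLabelling

variable {X : Type*} [TopologicalSpace X] {σ : X → X} {k : ℕ} {V : ℕ → Type*} {p : ∀ n, X → V n}

theorem eq_of_le (hp : IsLabelling σ k p) {m n : ℕ} (hmn : m ≤ n) {x y : X}
    (h : p n x = p n y) : p m x = p m y := by
  induction n, hmn using Nat.le_induction with
  | base => exact h
  | succ n _ ih => exact ih (hp.coarser n x y h)

theorem inj_of_le (hp : IsLabelling σ k p) {n : ℕ} (hn : k ≤ n) {x y : X}
    (h : p n x = p n y) (hσ : σ x = σ y) : x = y := hp.inj x y (hp.eq_of_le hn h) hσ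

theorem of_ker_eq (hp : IsLabelling σ k p) {W : ℕ → Type*} (q : ∀ n, X → W n)
    (h : ∀ n x y, q n x = q n y ↔ p n x = p n y) : IsLabelling σ k q where
  locConst n := by
    rw [IsLocallyConstant.iff_eventually_eq]
    intro x
    filter_upwards [(IsLocallyConstant.iff_eventually_eq _).1 (hp.locConst n) x] with y hy
    exact (h n y x).2 hy
  coarser n x y hxy := (h n x y).2 (hp.coarser n x y ((h _ x y).1 hxy))
  inj x y hxy := hp.inj x y ((h _ x y).1 hxy)
  even n hk hn x y hxy := by
    obtain ⟨x', h1, h2⟩ := hp.even n hk hn x y ((h _ _ _).1 hxy)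
    exact ⟨x', h1, (h _ _ _).2 h2⟩
  odd n hk hn x y hxy := (h _ _ _).2 (hp.odd n hk hn x y ((h _ _ _).1 hxy))
  separates x y hxy := hp.separates x y fun n => (h n x y).1 (hxy n)

theorem comp_homeomorph (hp : IsLabelling σ k p) {Y : Type*} [TopologicalSpace Y] {τ : Y → Y}
    (h : Y ≃ₜ X) (hh : ∀ y, h (τ y) = σ (h y)) : IsLabelling τ k fun n y => p n (h y) where
  locConst n := (hp.locConst n).comp_continuous h.continuous
  coarser n x y hxy := hp.coarser n _ _ hxy
  inj x y hxy hτ := h.injective (hp.inj _ _ hxy (by rw [← hh, hτ, hh]))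
  even n hk hn x y hxy := by
    obtain ⟨x', h1, h2⟩ := hp.even n hk hn (h x) (h y) (by rw [← hh]; exact hxy)
    refine ⟨h.symm x', h.injective ?_, by simpa using h2⟩
    rw [hh, h.apply_symm_apply, h1]
  odd n hk hn x y hxy := by
    simp only [hh]
    exact hp.odd n hk hn _ _ hxy
  separates x y hxy := h.injective (hp.separates _ _ hxy)

/-- The partitions of a labelling are eventually finer than any open cover of the diagonal. -/
theorem eventually_notMem [CompactSpace X] (hp : IsLabelling σ k p) {C : Set (X × X)}
    (hC : IsClosed C) (hdiag : ∀ x, (x, x) ∉ C) :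
    ∃ N, ∀ n, N ≤ n → ∀ x y, p n x = p n y → (x, y) ∉ C := by
  by_contra! hcon
  have hcl : ∀ n, IsClosed {z : X × X | p n z.1 = p n z.2} := by
    intro n
    have h : IsLocallyConstant fun z : X × X => (p n z.1, p n z.2) :=
      ((hp.locConst n).comp_continuous continuous_fst).prodMk
        ((hp.locConst n).comp_continuous continuous_snd)
    exact (h.isClopen_preimage {w | w.1 = w.2}).isClosed
  have hcl' : ∀ n, IsClosed ({z : X × X | p n z.1 = p n z.2} ∩ C) := fun n => (hcl n).inter hC
  obtain ⟨z, hz⟩ := IsCompact.nonempty_iInter_of_sequence_nonempty_isCompact_isClosed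
    (fun n => {z : X × X | p n z.1 = p n z.2} ∩ C)
    (fun n z hz => ⟨hp.coarser n _ _ hz.1, hz.2⟩)
    (fun n => by
      obtain ⟨m, hm, x, y, h1, h2⟩ := hcon n
      exact ⟨(x, y), hp.eq_of_le hm h1, h2⟩) (hcl' 0).isCompact hcl'
  rw [Set.mem_iInter] at hz
  obtain ⟨x, y⟩ := z
  have hxy : x = y := hp.separates x y fun n => (hz n).1
  subst hxy
  exact hdiag x (hz 0).2

theorem eventually_finer [CompactSpace X] (hp : IsLabelling σ k p) {W : Type*} {q : X → W}
    (hq : IsLocallyConstant q) : ∃ N, ∀ n, N ≤ n → ∀ x y, p n x = p n y → q x = q y := by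
  have h : IsLocallyConstant fun z : X × X => (q z.1, q z.2) :=
    (hq.comp_continuous continuous_fst).prodMk (hq.comp_continuous continuous_snd)
  obtain ⟨N, hN⟩ := hp.eventually_notMem (h.isClopen_preimage {w | w.1 ≠ w.2}).isClosed
    (fun x hx => hx rfl)
  refine ⟨N, fun n hn x y hxy => ?_⟩
  by_contra hne
  exact hN n hn x y hxy hne

/-- The layers of a labelling along a sequence of alternating parity. -/
theorem comp_seq (hp : IsLabelling σ k p) {m : ℕ → ℕ} (hm : StrictMono m)
    (hpar : ∀ n, Even (m n) ↔ Even n) (hk : k ≤ m 0) : IsLabelling σ 0 fun n => p (m n) where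
  locConst n := hp.locConst _
  coarser n x y h := hp.eq_of_le (hm n.lt_succ_self).le h
  inj x y h := hp.inj_of_le hk h
  even n _ hn x y h := by
    have h' : p (m n + 1) (σ x) = p (m n + 1) y := hp.eq_of_le (hm n.lt_succ_self) h
    exact hp.even (m n) (hk.trans (hm.monotone n.zero_le)) ((hpar n).2 hn) x y h'
  odd n _ hn x y h := by
    have h' : p (m n + 1) x = p (m n + 1) y := hp.eq_of_le (hm n.lt_succ_self) h
    exact hp.odd (m n) (hk.trans (hm.monotone n.zero_le))
      (Nat.not_even_iff_odd.1 fun h => Nat.not_even_iff_odd.2 hn ((hpar n).1 h)) x y h'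
  separates x y h := hp.separates x y fun n => hp.eq_of_le (hm.id_le n) (h n)

end IsLabelling

/-! ### Diagrams represented by a labelling -/

namespace ColoredDiagram

/-- The separations of the diagram are determined by the colours. -/
structure HasColorSep (F : ColoredDiagram.{u}) : Prop where
  even : ∀ n, Even n → ∀ v : F.V n, F.D v = {F.B v, F.Rv v}
  odd : ∀ n, Even n → ∀ v : F.V (n + 1),
    F.D v = {F.B v} ∪ {Y | ∃ f : F.E n, f ∈ F.red ∧ F.s f = v ∧ Y = F.R f}

/-- The separations given by `colorSeparation` are those of (a) and (b). -/
theorem hasColorSep_of_eq {F : ColoredDiagram.{u}}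
    (h : ∀ n (v : F.V n), F.D v = colorSeparation (V := F.V) (E := F.E) F.r F.s F.blue F.R v) :
    F.HasColorSep where
  even n hn v := by
    rw [h]
    rcases n with _ | n
    · rfl
    · have hn' : ¬ Odd (n + 1) := Nat.not_odd_iff_even.2 hn
      ext Y
      simp only [colorSeparation, hn, hn', true_and, false_and, or_false]
      exact Iff.rfl
  odd n hn v := by
    rw [h]
    have h1 : Odd (n + 1) := hn.add_one
    have h2 : ¬ Even (n + 1) := Nat.not_even_iff_odd.2 h1
    ext Y
    simp only [colorSeparation, h1, h2, true_and, false_and, false_or]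
    exact Iff.rfl

/-- The diagram `F` is, from the layer `k` on, the diagram of the sequence of partitions into the
fibres of the labelling `p`.  All inclusions between sets of the partitions are expressed through
points, which is equivalent for a labelling. -/
structure Represents (F : ColoredDiagram.{u}) {X : Type*} (σ : X → X) (k : ℕ)
    (p : ∀ n, X → F.V n) : Prop where
  surj : ∀ n, Function.Surjective (p n)
  blue_iff : ∀ n, k ≤ n → ∀ (w : F.V (n + 1)) (v : F.V n),
    (∃ e : F.E n, e ∈ F.blue ∧ F.s e = w ∧ F.r e = v) ↔ ∃ x, p (n + 1) x = w ∧ p n x = v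
  blue_ext : ∀ n, k ≤ n → ∀ e e' : F.E n, e ∈ F.blue → e' ∈ F.blue → F.s e = F.s e' →
    F.r e = F.r e' → e = e'
  red_iff : ∀ n, k ≤ n → ∀ (w : F.V (n + 1)) (v : F.V n),
    (∃ f : F.E n, f ∈ F.red ∧ F.s f = w ∧ F.r f = v) ↔
      ∃ x, p (n + 1) (alternate σ x (n + 1)) = w ∧ p n (alternate σ x n) = v
  red_ext : ∀ n, k ≤ n → ∀ f f' : F.E n, f ∈ F.red → f' ∈ F.red → F.s f = F.s f' →
    F.r f = F.r f' → f = f'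
  R_iff : ∀ n, k ≤ n → Even n → ∀ (f : F.E n) (g : F.E (n + 1)), f ∈ F.red →
    (g ∈ F.R f ↔ g ∈ F.red ∧ F.r g = F.s f ∧ ∃ x, p (n + 2) x = F.s g ∧ p n x = F.r f)

namespace Represents

theorem comp_equiv {F : ColoredDiagram.{u}} {X : Type*} {σ : X → X} {k : ℕ} {p : ∀ n, X → F.V n}
    (hF : F.Represents σ k p) {Y : Type*} {τ : Y → Y} (h : Y ≃ X)
    (hh : ∀ y, h (τ y) = σ (h y)) : F.Represents τ k fun n y => p n (h y) where
  surj n := (hF.surj n).comp h.surjective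
  blue_iff n hn w v := (hF.blue_iff n hn w v).trans h.surjective.exists
  blue_ext := hF.blue_ext
  red_iff n hn w v := by
    have : ∀ y m, h (alternate τ y m) = alternate σ (h y) m := by
      intro y m
      unfold alternate
      split_ifs
      · rfl
      · exact hh y
    simp only [this]
    exact (hF.red_iff n hn w v).trans h.surjective.exists
  red_ext := hF.red_ext
  R_iff n hn he f g hf := (hF.R_iff n hn he f g hf).trans
    (and_congr_right fun _ => and_congr_right fun _ => h.surjective.exists)

variable {F : ColoredDiagram.{u}} {X : Type*} {σ : X → X} {k : ℕ} {p : ∀ n, X → F.V n}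

section

variable (hF : F.Represents σ k p) {n : ℕ} (hk : k ≤ n)
include hF hk

theorem exists_blue (x : X) : ∃ e : F.E n, e ∈ F.blue ∧ F.s e = p (n + 1) x ∧ F.r e = p n x :=
  (hF.blue_iff n hk _ _).2 ⟨x, rfl, rfl⟩

theorem exists_red_even (hn : Even n) (x : X) :
    ∃ f : F.E n, f ∈ F.red ∧ F.s f = p (n + 1) (σ x) ∧ F.r f = p n x :=
  (hF.red_iff n hk _ _).2 ⟨x, by rw [alternate_odd σ x hn.add_one], by rw [alternate_even σ x hn]⟩

theorem exists_red_odd (hn : Odd n) (x : X) :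
    ∃ f : F.E n, f ∈ F.red ∧ F.s f = p (n + 1) x ∧ F.r f = p n (σ x) :=
  (hF.red_iff n hk _ _).2 ⟨x, by rw [alternate_even σ x hn.add_one], by rw [alternate_odd σ x hn]⟩

theorem mem_R_of {x : X} (hn : Even n) {f : F.E n} (hf : f ∈ F.red) {g : F.E (n + 1)}
    (hg : g ∈ F.red) (hrs : F.r g = F.s f) (hs : F.s g = p (n + 2) x) (hr : F.r f = p n x) :
    g ∈ F.R f := (hF.R_iff n hk hn f g hf).2 ⟨hg, hrs, x, hs.symm, hr.symm⟩

variable [TopologicalSpace X] (hp : IsLabelling σ k p)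
include hp

theorem r_of_blue {e : F.E n} (he : e ∈ F.blue) {x : X} (hs : F.s e = p (n + 1) x) :
    F.r e = p n x := by
  obtain ⟨y, h1, h2⟩ := (hF.blue_iff n hk _ _).1 ⟨e, he, rfl, rfl⟩
  rw [← h2]
  exact hp.coarser n _ _ (h1.trans hs)

theorem r_of_red_odd (hn : Odd n) {f : F.E n} (hf : f ∈ F.red) {x : X}
    (hs : F.s f = p (n + 1) x) : F.r f = p n (σ x) := by
  obtain ⟨y, h1, h2⟩ := (hF.red_iff n hk _ _).1 ⟨f, hf, rfl, rfl⟩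
  rw [alternate_even σ y hn.add_one] at h1
  rw [alternate_odd σ y hn] at h2
  rw [← h2]
  exact hp.odd n hk hn _ _ (h1.trans hs)

theorem exists_of_red_even (hn : Even n) {f : F.E n} (hf : f ∈ F.red) {y : X}
    (hs : F.s f = p (n + 1) y) : ∃ x, σ x = y ∧ p n x = F.r f := by
  obtain ⟨x, h1, h2⟩ := (hF.red_iff n hk _ _).1 ⟨f, hf, rfl, rfl⟩
  rw [alternate_odd σ x hn.add_one] at h1
  rw [alternate_even σ x hn] at h2
  obtain ⟨x', h3, h4⟩ := hp.even n hk hn x y (h1.trans hs)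
  exact ⟨x', h3, h4.trans h2⟩

theorem r_of_mem_R (hn : Even n) {f : F.E n} (hf : f ∈ F.red) {g : F.E (n + 1)} (hg : g ∈ F.R f)
    {x : X} (hs : F.s g = p (n + 2) x) : F.r f = p n x := by
  obtain ⟨-, -, y, h1, h2⟩ := (hF.R_iff n hk hn f g hf).1 hg
  rw [← h2]
  exact hp.eq_of_le (by omega) (h1.trans hs)

theorem blue_ext' {e e' : F.E n} (he : e ∈ F.blue) (he' : e' ∈ F.blue) (hs : F.s e = F.s e') :
    e = e' := by
  obtain ⟨x, hx⟩ := hF.surj _ (F.s e')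
  refine hF.blue_ext n hk e e' he he' hs ?_
  rw [hF.r_of_blue hk hp he (hs.trans hx.symm), hF.r_of_blue hk hp he' hx.symm]

theorem red_ext' (hn : Odd n) {f f' : F.E n} (hf : f ∈ F.red) (hf' : f' ∈ F.red)
    (hs : F.s f = F.s f') : f = f' := by
  obtain ⟨x, hx⟩ := hF.surj _ (F.s f')
  refine hF.red_ext n hk f f' hf hf' hs ?_
  rw [hF.r_of_red_odd hk hp hn hf (hs.trans hx.symm), hF.r_of_red_odd hk hp hn hf' hx.symm]

end

variable [TopologicalSpace X]

/-! ### Represented diagrams are `l`-diagrams -/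

/-- The diagram of a sequence of partitions that satisfies the conditions of a `σ`-refined sequence
is an `l`-diagram. -/
theorem isLDiagram [CompactSpace X] [Nonempty X] (hF : F.Represents σ 0 p) (hp : IsLabelling σ 0 p)
    (hσ : Function.Surjective σ) (hD : F.HasColorSep) : F.IsLDiagram := by
  have z : ∀ n, 0 ≤ n := Nat.zero_le
  have finV : ∀ n, Finite (F.V n) := fun n => by
    have := (hp.locConst n).range_finite
    rw [(hF.surj n).range_eq] at this
    exact Set.finite_univ_iff.1 this
  have blue_ne : ∀ n (v : F.V n), (F.B v).Nonempty := by
    intro n v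
    obtain ⟨x, rfl⟩ := hF.surj n v
    obtain ⟨e, he, -, hr⟩ := hF.exists_blue (z n) x
    exact ⟨e, he, hr⟩
  have red_ne : ∀ n, Even n → ∀ v : F.V n, (F.Rv v).Nonempty := by
    intro n hn v
    obtain ⟨x, rfl⟩ := hF.surj n v
    obtain ⟨f, hf, -, hr⟩ := hF.exists_red_even (z n) hn x
    exact ⟨f, hf, hr⟩
  have R_sub : ∀ n, Even n → ∀ f : F.E n, f ∈ F.red → ∀ g ∈ F.R f, g ∈ F.red ∧ F.r g = F.s f := by
    intro n hn f hf g hg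
    obtain ⟨h1, h2, -⟩ := (hF.R_iff n (z n) hn f g hf).1 hg
    exact ⟨h1, h2⟩
  have R_ne : ∀ n, Even n → ∀ f : F.E n, f ∈ F.red → (F.R f).Nonempty := by
    intro n hn f hf
    obtain ⟨y, hy⟩ := hF.surj _ (F.s f)
    obtain ⟨x, rfl, hx⟩ := hF.exists_of_red_even (z n) hp hn hf hy.symm
    obtain ⟨g, hg, hgs, hgr⟩ := hF.exists_red_odd (z (n + 1)) hn.add_one x
    exact ⟨g, hF.mem_R_of (z n) hn hf hg (hgr.trans hy) hgs hx.symm⟩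
  have R_ex : ∀ n, Even n → ∀ g : F.E (n + 1), g ∈ F.red →
      ∃ f : F.E n, f ∈ F.red ∧ F.s f = F.r g ∧ g ∈ F.R f := by
    intro n hn g hg
    obtain ⟨x, hx⟩ := hF.surj _ (F.s g)
    have hr := hF.r_of_red_odd (z (n + 1)) hp hn.add_one hg hx.symm
    obtain ⟨f, hf, hfs, hfr⟩ := hF.exists_red_even (z n) hn x
    exact ⟨f, hf, hfs.trans hr.symm, hF.mem_R_of (z n) hn hf hg (hr.trans hfs.symm) hx.symm hfr⟩
  have R_inj : ∀ n, Even n → ∀ f f' : F.E n, f ∈ F.red → f' ∈ F.red → ∀ g ∈ F.R f, ∀ g' ∈ F.R f',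
      F.s g = F.s g' → f = f' := by
    intro n hn f f' hf hf' g hg g' hg' hs
    obtain ⟨x, hx⟩ := hF.surj _ (F.s g')
    have hgg : g = g' :=
      hF.red_ext' (z (n + 1)) hp hn.add_one (R_sub n hn f hf g hg).1 (R_sub n hn f' hf' g' hg').1 hs
    refine hF.red_ext n (z n) f f' hf hf' ?_ ?_
    · rw [← (R_sub n hn f hf g hg).2, ← (R_sub n hn f' hf' g' hg').2, hgg]
    · rw [hF.r_of_mem_R (z n) hp hn hf hg (hs.trans hx.symm),
        hF.r_of_mem_R (z n) hp hn hf' hg' hx.symm]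
  have R_iUnion : ∀ n, Even n → ∀ v : F.V (n + 1),
      F.Rv v = ⋃ f ∈ {f : F.E n | f ∈ F.red ∧ F.s f = v}, F.R f := by
    intro n hn v
    ext g
    simp only [Set.mem_iUnion]
    constructor
    · rintro ⟨hg, rfl⟩
      obtain ⟨f, hf, hs, hgf⟩ := R_ex n hn g hg
      exact ⟨f, ⟨hf, hs⟩, hgf⟩
    · rintro ⟨f, ⟨hf, rfl⟩, hg⟩
      exact R_sub n hn f hf g hg
  have edge_ext : ∀ n, Function.Injective fun e : F.E n => (F.s e, F.r e, e ∈ F.blue) := by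
    intro n e e' h
    obtain ⟨h1, h2, h3⟩ := by simpa using h
    by_cases he : e ∈ F.blue
    · exact hF.blue_ext n (z n) e e' he (h3.1 he) h1 h2
    · exact hF.red_ext n (z n) e e' he (fun he' => he (h3.2 he')) h1 h2
  have blue_cover : ∀ n, ⋃ v : F.V n, F.s '' F.B v = Set.univ := by
    intro n
    refine Set.eq_univ_of_forall fun w => ?_
    obtain ⟨x, rfl⟩ := hF.surj _ w
    obtain ⟨e, he, hs, hr⟩ := hF.exists_blue (z n) x
    exact Set.mem_iUnion.2 ⟨F.r e, e, ⟨he, rfl⟩, hs⟩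
  have blue_disj : ∀ n, Pairwise fun v w : F.V n => Disjoint (F.s '' F.B v) (F.s '' F.B w) := by
    intro n v w hvw
    refine Set.disjoint_left.2 ?_
    rintro _ ⟨e, ⟨he, rfl⟩, rfl⟩ ⟨e', ⟨he', rfl⟩, hs⟩
    exact hvw (by rw [hF.blue_ext' (z n) hp he he' hs.symm])
  refine
    { finite_V := finV
      nonempty_V := fun n => ‹Nonempty X›.map (p n)
      finite_E := fun n => Finite.of_injective _ (edge_ext n)
      nonempty_E := fun n => ?_
      range_surjective := fun n v => ?_
      source_surjective := fun n w => ?_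
      partition := fun n v => ?_
      sep_even := hD.even
      blue_nonempty := blue_ne
      red_nonempty := red_ne
      sep_odd := hD.odd
      R_nonempty := R_ne
      R_iUnion := R_iUnion
      R_disjoint := fun n hn v f hf f' hf' hne => Set.disjoint_left.2 fun g hg hg' =>
        hne (R_inj n hn f f' hf.1 hf'.1 g hg g hg' rfl)
      even_blue := fun n _ => blue_cover n
      even_blue_disjoint := fun n _ => blue_disj n
      even_red := fun n hn => Set.eq_univ_of_forall fun w => ?_
      even_red_disjoint := fun n hn v w hvw => Set.disjoint_left.2 ?_
      even_blue_inj := fun n _ v e he e' he' hs => hF.blue_ext' (z n) hp he.1 he'.1 hs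
      even_red_inj := fun n hn v f hf f' hf' hs => hF.red_ext' (z n) hp hn hf.1 hf'.1 hs
      first_blue := blue_cover 0
      first_blue_disjoint := blue_disj 0
      first_red := Set.eq_univ_of_forall fun w => ?_
      odd_blue_inj := fun n _ e he e' he' hs => hF.blue_ext' (z n) hp he he' hs
      compat := fun n hn v => ?_
      compat_blue_disjoint := fun n hn v e he e' he' hne => Set.disjoint_left.2 ?_
      compat_red_disjoint := fun n hn v f hf f' hf' hne => Set.disjoint_left.2 ?_
      romb_red := fun n hn f₀ f₁ hf₀ hf₁ hfs => ?_
      romb_blue := fun n hn g e₀ e₁ hg he₀ he₁ hr hs => ?_ }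
  · obtain ⟨v⟩ := ‹Nonempty X›.map (p n)
    exact ⟨(blue_ne n v).some⟩
  · obtain ⟨e, -, he⟩ := blue_ne n v
    exact ⟨e, he⟩
  · obtain ⟨x, rfl⟩ := hF.surj _ w
    obtain ⟨e, -, hs, -⟩ := hF.exists_blue (z n) x
    exact ⟨e, hs⟩
  · rcases Nat.even_or_odd n with hn | hn
    · rw [hD.even n hn v]
      refine ⟨?_, ?_, ?_⟩
      · rintro Y (rfl | rfl)
        exacts [blue_ne n v, red_ne n hn v]
      · have hd : Disjoint (F.B v) (F.Rv v) := Set.disjoint_left.2 fun e he he' => he'.1 he.1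
        rintro Y (rfl | rfl) Y' (rfl | rfl) hne
        exacts [absurd rfl hne, hd, hd.symm, absurd rfl hne]
      · ext e
        simp only [Set.sUnion_insert, Set.sUnion_singleton]
        constructor
        · rintro (h | h)
          exacts [h.2, h.2]
        · intro h
          by_cases he : e ∈ F.blue
          exacts [Or.inl ⟨he, h⟩, Or.inr ⟨he, h⟩]
    · obtain ⟨n, rfl⟩ : ∃ m, n = m + 1 := ⟨n - 1, by grind⟩
      have hn' : Even n := by grind
      rw [hD.odd n hn' v]
      refine ⟨?_, ?_, ?_⟩
      · rintro Y (rfl | ⟨f, hf, rfl, rfl⟩)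
        exacts [blue_ne _ v, R_ne n hn' f hf]
      · have hd : ∀ f : F.E n, f ∈ F.red → Disjoint (F.B v) (F.R f) := fun f hf =>
          Set.disjoint_left.2 fun e he he' => (R_sub n hn' f hf e he').1 he.1
        rintro Y (rfl | ⟨f, hf, hfs, rfl⟩) Y' (rfl | ⟨f', hf', hfs', rfl⟩) hne
        · exact absurd rfl hne
        · exact hd f' hf'
        · exact (hd f hf).symm
        · refine Set.disjoint_left.2 fun g hg hg' => hne ?_
          rw [R_inj n hn' f f' hf hf' g hg g hg' rfl]
      · ext e
        constructor
        · rintro ⟨Y, (rfl | ⟨f, hf, rfl, rfl⟩), he⟩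
          exacts [he.2, (R_sub n hn' f hf e he).2]
        · intro h
          by_cases he : e ∈ F.blue
          · exact ⟨F.B v, Or.inl rfl, he, h⟩
          · obtain ⟨f, hf, hfs, hef⟩ := R_ex n hn' e he
            exact ⟨F.R f, Or.inr ⟨f, hf, hfs.trans h, rfl⟩, hef⟩
  · obtain ⟨x, rfl⟩ := hF.surj _ w
    obtain ⟨f, hf, hs, -⟩ := hF.exists_red_odd (z n) hn x
    exact Set.mem_iUnion.2 ⟨F.r f, f, ⟨hf, rfl⟩, hs⟩
  · rintro _ ⟨e, ⟨he, rfl⟩, rfl⟩ ⟨e', ⟨he', rfl⟩, hs⟩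
    exact hvw (by rw [hF.red_ext' (z n) hp hn he he' hs.symm])
  · obtain ⟨y, rfl⟩ := hF.surj _ w
    obtain ⟨x, rfl⟩ := hσ y
    obtain ⟨f, hf, hs, -⟩ := hF.exists_red_even (z 0) (by decide) x
    exact Set.mem_iUnion.2 ⟨F.r f, f, ⟨hf, rfl⟩, hs⟩
  · ext w
    obtain ⟨x, rfl⟩ := hF.surj _ w
    simp only [Set.mem_iUnion]
    constructor
    · rintro ⟨e, ⟨he, rfl⟩, e', ⟨he', her⟩, hs⟩
      have h1 := hF.r_of_blue (z _) hp he' hs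
      have h2 := hF.r_of_blue (z n) hp he (her.symm.trans h1)
      obtain ⟨f, hf, hfs, hfr⟩ := hF.exists_red_even (z n) hn x
      obtain ⟨g, hg, hgs, hgr⟩ := hF.exists_red_odd (z (n + 1)) hn.add_one x
      exact ⟨f, ⟨hf, hfr.trans h2.symm⟩, g,
        hF.mem_R_of (z n) hn hf hg (hgr.trans hfs.symm) hgs hfr, hgs⟩
    · rintro ⟨f, ⟨hf, rfl⟩, g, hg, hs⟩
      have h1 := hF.r_of_mem_R (z n) hp hn hf hg hs
      obtain ⟨e, he, hes, her⟩ := hF.exists_blue (z n) x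
      obtain ⟨e', he', hes', her'⟩ := hF.exists_blue (z (n + 1)) x
      exact ⟨e, ⟨he, her.trans h1.symm⟩, e', ⟨he', her'.trans hes.symm⟩, hes'⟩
  · rintro _ ⟨e₁, ⟨he₁, h₁⟩, rfl⟩ ⟨e₁', ⟨he₁', h₁'⟩, hs⟩
    refine hne (hF.blue_ext' (z n) hp he.1 he'.1 ?_)
    rw [← h₁, ← h₁', hF.blue_ext' (z _) hp he₁ he₁' hs.symm]
  · rintro _ ⟨g, hg, rfl⟩ ⟨g', hg', hs⟩
    exact hne (R_inj n hn f f' hf.1 hf'.1 g hg g' hg' hs.symm)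
  · -- A point `y = σ x` in the source of `f₁`, where `x` lies in the source of `f₀`.
    obtain ⟨y, hy⟩ := hF.surj _ (F.s f₁)
    obtain ⟨x, rfl, hx⟩ := hF.exists_of_red_even (z _) hp hn.add_one hf₁ hy.symm
    have hr := hF.r_of_red_odd (z n) hp hn hf₀ (hfs.trans hx.symm)
    obtain ⟨e, he, hes, her⟩ := hF.exists_blue (z n) (σ x)
    obtain ⟨e', he', hes', her'⟩ := hF.exists_blue (z (n + 1)) (σ x)
    refine ⟨(e, e'), ⟨he, he', her.trans hr.symm, hes.trans her'.symm, hes'.trans hy⟩, ?_⟩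
    rintro ⟨q, q'⟩ ⟨h1, h2, h3, h4, h5⟩
    have h6 : q' = e' := hF.blue_ext' (z _) hp h2 he' (h5.trans (hy.symm.trans hes'.symm))
    subst h6
    exact Prod.ext (hF.blue_ext' (z n) hp h1 he (h4.trans (her'.trans hes.symm))) rfl
  · -- A point `y = σ x` in the source of `e₁`, where `x` lies in the range of `g`.
    obtain ⟨y, hy⟩ := hF.surj _ (F.s e₁)
    have h1 := hF.r_of_blue (z _) hp he₁ hy.symm
    have h2 := hF.r_of_blue (z _) hp he₀ (hs.trans h1)
    obtain ⟨x, rfl, hx⟩ := hF.exists_of_red_even (z n) hp hn hg (hr.symm.trans h2)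
    obtain ⟨f₀, hf₀, hfs₀, hfr₀⟩ := hF.exists_red_odd (z (n + 1)) hn.add_one x
    obtain ⟨f₁, hf₁, hfs₁, hfr₁⟩ := hF.exists_red_even (z (n + 2)) (by grind) x
    refine ⟨(f₀, f₁), ⟨hf₀, hf₁, hF.mem_R_of (z n) hn hg hf₀
      (hfr₀.trans (h2.symm.trans hr)) hfs₀ hx.symm, hfr₀.trans h2.symm, hfs₀.trans hfr₁.symm,
      hfs₁.trans hy⟩, ?_⟩
    rintro ⟨q, q'⟩ ⟨k1, k2, k3, k4, k5, k6⟩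
    obtain ⟨x', h3, h4⟩ := hF.exists_of_red_even (z (n + 2)) hp (by grind) k2 (k6.trans hy.symm)
    have h5 := hF.r_of_mem_R (z n) hp hn hg k3 (k5.trans h4.symm)
    have h6 : x' = x := hp.inj_of_le (z n) (h5.symm.trans hx.symm) h3
    subst h6
    have h7 : q = f₀ := hF.red_ext' (z _) hp hn.add_one k1 hf₀
      (k5.trans (h4.symm.trans hfs₀.symm))
    exact Prod.ext h7 (hF.red_ext _ (z _) _ _ k2 hf₁ (k6.trans (hy.symm.trans hfs₁.symm))
      (h4.symm.trans hfr₁.symm))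

end Represents
end ColoredDiagram
namespace ColoredDiagram
namespace Represents

variable {F G : ColoredDiagram.{u}} {X : Type*} {σ : X → X} {k : ℕ} {p : ∀ n, X → F.V n}
  {q : ∀ n, X → G.V n}

/-! ### Uniqueness of represented diagrams -/

theorem edge_ext (hF : F.Represents σ k p) {n : ℕ} (hk : k ≤ n) {e e' : F.E n}
    (hs : F.s e = F.s e') (hr : F.r e = F.r e') (hc : e ∈ F.blue ↔ e' ∈ F.blue) : e = e' := by
  by_cases he : e ∈ F.blue
  · exact hF.blue_ext n hk e e' he (hc.1 he) hs hr
  · exact hF.red_ext n hk e e' he (fun he' => he (hc.2 he')) hs hr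

/-- Labellings with the same fibres have the same vertices. -/
theorem exists_vertexEquiv (hF : F.Represents σ 0 p) (hG : G.Represents σ 0 q)
    (hpq : ∀ n x y, p n x = p n y ↔ q n x = q n y) :
    ∃ φ : ∀ n, F.V n ≃ G.V n, ∀ n x, φ n (p n x) = q n x := by
  choose a ha using hF.surj
  have h : ∀ n x, q n (a n (p n x)) = q n x := fun n x => (hpq n _ _).1 (ha n _)
  refine ⟨fun n => Equiv.ofBijective (fun v => q n (a n v)) ⟨fun v w hvw => ?_, fun v => ?_⟩, h⟩
  · rw [← ha n v, ← ha n w]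
    exact (hpq n _ _).2 hvw
  · obtain ⟨x, rfl⟩ := hG.surj n v
    exact ⟨p n x, h n x⟩

theorem exists_edge (hF : F.Represents σ 0 p) (hG : G.Represents σ 0 q)
    {φ : ∀ n, F.V n ≃ G.V n} (hφ : ∀ n x, φ n (p n x) = q n x) (n : ℕ) (e : F.E n) :
    ∃ e' : G.E n, G.s e' = φ (n + 1) (F.s e) ∧ G.r e' = φ n (F.r e) ∧
      (e' ∈ G.blue ↔ e ∈ F.blue) := by
  by_cases he : e ∈ F.blue
  · obtain ⟨x, h1, h2⟩ := (hF.blue_iff n n.zero_le _ _).1 ⟨e, he, rfl, rfl⟩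
    obtain ⟨e', he', hs, hr⟩ := (hG.blue_iff n n.zero_le _ _).2 ⟨x, rfl, rfl⟩
    exact ⟨e', by rw [hs, ← h1, hφ], by rw [hr, ← h2, hφ], iff_of_true he' he⟩
  · obtain ⟨x, h1, h2⟩ := (hF.red_iff n n.zero_le _ _).1 ⟨e, he, rfl, rfl⟩
    obtain ⟨e', he', hs, hr⟩ := (hG.red_iff n n.zero_le _ _).2 ⟨x, rfl, rfl⟩
    exact ⟨e', by rw [hs, ← h1, hφ], by rw [hr, ← h2, hφ], iff_of_false he' he⟩

/-- Two diagrams that are represented by the same partitions of the same system are isomorphic. -/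
theorem iso (hF : F.Represents σ 0 p) (hG : G.Represents σ 0 q)
    (hpq : ∀ n x y, p n x = p n y ↔ q n x = q n y) (hFD : F.HasColorSep) (hGD : G.HasColorSep) :
    F.Iso G := by
  have z : ∀ n, 0 ≤ n := Nat.zero_le
  obtain ⟨φ, hφ⟩ := hF.exists_vertexEquiv hG hpq
  choose ψ hs hr hb using hF.exists_edge hG hφ
  have hinj : ∀ n, Function.Injective (ψ n) := by
    intro n e e' h
    refine hF.edge_ext (z n) ((φ _).injective ?_) ((φ _).injective ?_) ?_
    · rw [← hs, ← hs, h]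
    · rw [← hr, ← hr, h]
    · rw [← hb, ← hb, h]
  have hsurj : ∀ n, Function.Surjective (ψ n) := by
    intro n e'
    obtain ⟨e, h1, h2, h3⟩ := hG.exists_edge hF (φ := fun n => (φ n).symm)
      (fun n x => by rw [← hφ, Equiv.symm_apply_apply]) n e'
    refine ⟨e, hG.edge_ext (z n) ?_ ?_ ((hb n e).trans h3)⟩
    · rw [hs, h1, Equiv.apply_symm_apply]
    · rw [hr, h2, Equiv.apply_symm_apply]
  have hB : ∀ n (v : F.V n), ψ n '' F.B v = G.B (φ n v) := by
    intro n v
    ext e'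
    constructor
    · rintro ⟨e, ⟨he, rfl⟩, rfl⟩
      exact ⟨(hb n e).2 he, hr n e⟩
    · rintro ⟨h1, h2⟩
      obtain ⟨e, rfl⟩ := hsurj n e'
      exact ⟨e, ⟨(hb n e).1 h1, (φ n).injective (by rw [← hr, h2])⟩, rfl⟩
  have hRv : ∀ n (v : F.V n), ψ n '' F.Rv v = G.Rv (φ n v) := by
    intro n v
    ext e'
    constructor
    · rintro ⟨e, ⟨he, rfl⟩, rfl⟩
      exact ⟨fun h => he ((hb n e).1 h), hr n e⟩
    · rintro ⟨h1, h2⟩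
      obtain ⟨e, rfl⟩ := hsurj n e'
      exact ⟨e, ⟨fun h => h1 ((hb n e).2 h), (φ n).injective (by rw [← hr, h2])⟩, rfl⟩
  have hR : ∀ n, Even n → ∀ f : F.E n, f ∈ F.red → ψ (n + 1) '' F.R f = G.R (ψ n f) := by
    intro n hn f hf
    have hf' : ψ n f ∈ G.red := fun h => hf ((hb n f).1 h)
    have key : ∀ g : F.E (n + 1), ψ (n + 1) g ∈ G.R (ψ n f) ↔ g ∈ F.R f := by
      intro g
      rw [hF.R_iff n (z n) hn f g hf, hG.R_iff n (z n) hn _ _ hf', hs, hr, hs, hr,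
        (φ (n + 1)).apply_eq_iff_eq]
      simp only [← hφ, (φ _).apply_eq_iff_eq]
      exact and_congr_left fun _ => not_congr (hb (n + 1) g)
    ext g'
    constructor
    · rintro ⟨g, hg, rfl⟩
      exact (key g).2 hg
    · intro hg'
      obtain ⟨g, rfl⟩ := hsurj _ g'
      exact ⟨g, (key g).1 hg', rfl⟩
  refine ⟨φ, fun n => Equiv.ofBijective (ψ n) ⟨hinj n, hsurj n⟩, hr, hs, ?_, hB, hRv, hR⟩
  intro n v
  rcases Nat.even_or_odd n with hn | hn
  · rw [hFD.even n hn, hGD.even n hn, Set.image_pair]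
    exact congrArg₂ _ (hB n v) (congrArg _ (hRv n v))
  · obtain ⟨n, rfl⟩ : ∃ m, n = m + 1 := ⟨n - 1, by grind⟩
    have hn' : Even n := by grind
    rw [hFD.odd n hn', hGD.odd n hn', Set.image_union, Set.image_singleton]
    refine congrArg₂ _ (congrArg _ (hB _ v)) ?_
    ext Y
    constructor
    · rintro ⟨_, ⟨f, hf, rfl, rfl⟩, rfl⟩
      exact ⟨ψ n f, fun h => hf ((hb n f).1 h), hs n f, hR n hn' f hf⟩
    · rintro ⟨f', hf', h1, rfl⟩
      obtain ⟨f, rfl⟩ := hsurj n f'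
      have hf : f ∈ F.red := fun h => hf' ((hb n f).2 h)
      exact ⟨F.R f, ⟨f, hf, (φ (n + 1)).injective (by rw [← hs, h1]), rfl⟩, hR n hn' f hf⟩

end Represents

/-! ### The path space represents its diagram -/

namespace IsLDiagram

variable {F : ColoredDiagram.{u}} (hF : F.IsLDiagram)
include hF

/-- The map of the path space may fail to be injective on the sets of paths through a given vertex
of layer `0`, but it is injective on those for layer `2`. -/
theorem isLabelling_vert : IsLabelling hF.shift 2 (vert (F := F)) where
  locConst := isLocallyConstant_vert
  coarser n x y h := hF.vert_eq_of_le n.le_succ h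
  inj x y h hσ := by
    have h2 : Even 2 := even_two
    obtain ⟨f, hf, hx⟩ := hF.exists_redCylinder h2 x
    obtain ⟨f', hf', hy⟩ := hF.exists_redCylinder h2 y
    have hff : f = f' := hF.red_ext_of_even (n := 0) ⟨0, rfl⟩ hf hf'
      (by rw [← hF.vert_shift_of_mem_redCylinder h2 hf hx, hσ,
        hF.vert_shift_of_mem_redCylinder h2 hf' hy])
      (by rw [← hF.vert_of_mem_redCylinder h2 hf hx, h, hF.vert_of_mem_redCylinder h2 hf' hy])
    subst hff
    exact hF.shift_injOn h2 hf hx hy hσ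
  even n _ hn x y h := by
    obtain ⟨f, hf, hx⟩ := hF.exists_redCylinder hn x
    have hy : y ∈ hF.shift '' redCylinder f := by
      rw [hF.image_redCylinder hn hf]
      exact h.symm.trans (hF.vert_shift_of_mem_redCylinder hn hf hx)
    obtain ⟨x', hx', rfl⟩ := hy
    exact ⟨x', rfl, by rw [hF.vert_of_mem_redCylinder hn hf hx, hF.vert_of_mem_redCylinder hn hf hx']⟩
  odd n _ hn x y h := by
    obtain ⟨f, hf, hs, hr⟩ := hF.exists_red_shift_odd hn x
    rw [← hr, hF.r_of_red_odd hn hf (hs.trans h)]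
  separates x y h := hF.path_ext fun N => ⟨N, le_rfl, h N⟩

theorem represents_vert : F.Represents hF.shift 2 (vert (F := F)) where
  surj := hF.vert_surjective
  blue_iff n _ w v := by
    constructor
    · rintro ⟨e, he, rfl, rfl⟩
      obtain ⟨x, hx⟩ := hF.vert_surjective (n + 1) (F.s e)
      exact ⟨x, hx, by rw [← hF.parent_vert, hx, hF.parent_s he]⟩
    · rintro ⟨x, rfl, rfl⟩
      exact ⟨x.1 n, (x.2 n).1, s_eq_vert n x, rfl⟩
  blue_ext n _ e e' he he' hs _ := hF.blue_ext he he' hs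
  red_iff n _ w v := by
    rcases Nat.even_or_odd n with hn | hn
    · simp only [alternate_even _ _ hn, alternate_odd _ _ hn.add_one]
      constructor
      · rintro ⟨f, hf, rfl, rfl⟩
        obtain ⟨g, hg⟩ := hF.R_nonempty n hn f hf
        obtain ⟨x, hx⟩ := hF.vert_surjective (n + 2) (F.s g)
        have hxf : x ∈ redCylinder f := ⟨g, hg, hx.symm⟩
        exact ⟨x, hF.vert_shift_of_mem_redCylinder hn hf hxf, hF.vert_of_mem_redCylinder hn hf hxf⟩
      · rintro ⟨x, rfl, rfl⟩
        obtain ⟨f, hf, hx⟩ := hF.exists_redCylinder hn x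
        exact ⟨f, hf, (hF.vert_shift_of_mem_redCylinder hn hf hx).symm,
          (hF.vert_of_mem_redCylinder hn hf hx).symm⟩
    · simp only [alternate_odd _ _ hn, alternate_even _ _ hn.add_one]
      constructor
      · rintro ⟨f, hf, rfl, rfl⟩
        obtain ⟨x, hx⟩ := hF.vert_surjective (n + 1) (F.s f)
        exact ⟨x, hx, (hF.r_of_red_odd hn hf hx.symm).symm⟩
      · rintro ⟨x, rfl, rfl⟩
        exact hF.exists_red_shift_odd hn x
  red_ext n hn f f' hf hf' hs hr := by
    rcases Nat.even_or_odd n with h | h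
    · obtain ⟨m, rfl⟩ : ∃ m, n = m + 2 := ⟨n - 2, by omega⟩
      exact hF.red_ext_of_even (by grind) hf hf' hs hr
    · exact hF.red_ext h hf hf' hs
  R_iff n hn he f g hf := by
    constructor
    · intro hg
      obtain ⟨x, hx⟩ := hF.vert_surjective (n + 2) (F.s g)
      exact ⟨(hF.mem_R he hf hg).1, (hF.mem_R he hf hg).2, x, hx,
        hF.vert_of_mem_redCylinder he hf ⟨g, hg, hx.symm⟩⟩
    · rintro ⟨hg, hgr, x, hx, hxf⟩
      obtain ⟨f', hf', hs', hgf'⟩ := hF.exists_mem_R he hg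
      have hr' : F.r f' = F.r f := by
        rw [← hxf, ← hF.parent_parent_of_mem_R he hf' hgf', ← hx, hF.parent_vert, hF.parent_vert]
      obtain ⟨m, rfl⟩ : ∃ m, n = m + 2 := ⟨n - 2, by omega⟩
      rwa [← hF.red_ext_of_even (by grind) hf' hf (hs'.trans hgr) hr']

end IsLDiagram

/-! ### Contractions of represented diagrams -/

theorem IsContractionSeq.even_iff {m : ℕ → ℕ} (hm : IsContractionSeq m) (n : ℕ) :
    Even (m n) ↔ Even n := by
  induction n with
  | zero => exact iff_of_true hm.2.1 ⟨0, rfl⟩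
  | succ n ih =>
    have h1 := hm.2.2 n
    have h2 : m n < m (n + 1) := hm.1 n.lt_succ_self
    have h3 : (m (n + 1) - m n) % 2 = 1 := h1
    rw [Nat.even_iff, Nat.even_iff] at ih ⊢
    omega

theorem isContractionSeq_of_even_iff {m : ℕ → ℕ} (hm : StrictMono m)
    (h : ∀ n, Even (m n) ↔ Even n) : IsContractionSeq m := by
  refine ⟨hm, (h 0).2 ⟨0, rfl⟩, fun n => ?_⟩
  change (m (n + 1) - m n) % 2 = 1
  have h1 := h n
  have h2 := h (n + 1)
  have h3 : m n < m (n + 1) := hm n.lt_succ_self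
  rw [Nat.even_iff, Nat.even_iff] at h1 h2
  omega

theorem hasColorSep_contract (F : ColoredDiagram.{u}) (m : ℕ → ℕ) (hm : StrictMono m) :
    (F.contract m hm).HasColorSep := hasColorSep_of_eq fun _ _ => rfl

theorem FinPath.ext' {F : ColoredDiagram.{u}} {j l : ℕ} {a b : F.FinPath j l}
    (hv : ∀ i h h', a.vert i h h' = b.vert i h h') (he : ∀ i h h', a.edge i h h' = b.edge i h h') :
    a = b := by
  obtain ⟨av, ae, _, _⟩ := a
  obtain ⟨bv, be, _, _⟩ := b
  obtain rfl : av = bv := by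
    funext i h h'
    exact hv i h h'
  obtain rfl : ae = be := by
    funext i h h'
    exact he i h h'
  rfl

/-- Downwards induction on the vertices `j, …, l` of a path. -/
theorem down_induction {j l : ℕ} {Q : ℕ → Prop} (hl : Q l)
    (hstep : ∀ i, j ≤ i → i < l → Q (i + 1) → Q i) : ∀ i, j ≤ i → i ≤ l → Q i := by
  intro i hj hi
  induction l, hi using Nat.le_induction with
  | base => exact hl
  | succ l hl' ih =>
    exact ih (hstep l (hj.trans hl') l.lt_succ_self hl)
      (fun i h h' => hstep i h (h'.trans l.lt_succ_self))

/-- Downwards induction with two steps at a time on the vertices `j, …, l` of a path. -/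
theorem down_induction_two {j l : ℕ} {Q : ℕ → Prop} (hjl : j < l) (hl : Q l) (hl' : Q (l - 1))
    (hstep : ∀ i, j ≤ i → i + 1 < l → Q (i + 1) → Q (i + 2) → Q i) :
    ∀ i, j ≤ i → i ≤ l → Q i := by
  have key : ∀ i, j ≤ i → i ≤ l - 1 → Q i ∧ Q (i + 1) :=
    down_induction (Q := fun i => Q i ∧ Q (i + 1))
      ⟨hl', by rwa [Nat.sub_add_cancel (by omega)]⟩
      fun i h h' hq => ⟨hstep i h (by omega) hq.1 hq.2, hq.1⟩
  intro i hj hi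
  rcases hi.eq_or_lt with rfl | hi
  · exact hl
  · exact (key i hj (by omega)).1

namespace Represents

variable {F : ColoredDiagram.{u}} {X : Type*} [TopologicalSpace X] {σ : X → X} {k : ℕ}
  {p : ∀ n, X → F.V n}

theorem vert_bluePath (hF : F.Represents σ k p) (hp : IsLabelling σ k p) {j l : ℕ} (hk : k ≤ j)
    (hjl : j ≤ l) (b : F.BluePath j l) {x : X} (hx : p l x = b.1.vert l hjl le_rfl) :
    ∀ i h h', b.1.vert i h h' = p i x := by
  have := down_induction (j := j) (l := l) (Q := fun i => ∀ h h', b.1.vert i h h' = p i x)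
    (fun _ _ => hx.symm) (fun i h h' ih _ _ => by
      rw [← b.1.range_edge i h h']
      exact hF.r_of_blue (hk.trans h) hp (b.2 i h h')
        ((b.1.source_edge i h h').trans (ih _ _)))
  exact fun i h h' => this i h h' h h'

omit [TopologicalSpace X] in
theorem exists_bluePath (hF : F.Represents σ k p) (j l : ℕ) (hk : k ≤ j) (x : X) :
    ∃ b : F.BluePath j l, ∀ i h h', b.1.vert i h h' = p i x := by
  choose e he using fun i (h : k ≤ i) => hF.exists_blue h x
  exact ⟨⟨⟨fun i _ _ => p i x, fun i h _ => e i (hk.trans h), fun i h _ => (he i _).2.2,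
    fun i h _ => (he i _).2.1⟩, fun i h _ => (he i _).1⟩, fun _ _ _ => rfl⟩

/-- The vertices of a red path of odd length alternate between the labels of a point `x` and those
of `σ x`. -/
theorem vert_redPath (hF : F.Represents σ k p) (hp : IsLabelling σ k p) {j l : ℕ} (hk : k ≤ j)
    (hjl : j < l) (b : F.RedPath j l) {x : X}
    (h0 : b.1.vert l hjl.le le_rfl = p l (alternate σ x l))
    (h1 : b.1.vert (l - 1) (Nat.le_sub_one_of_lt hjl) (Nat.sub_le _ _) =
      p (l - 1) (alternate σ x (l - 1))) :
    ∀ i h h', b.1.vert i h h' = p i (alternate σ x i) := by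
  have := down_induction_two (j := j) (l := l)
    (Q := fun i => ∀ h h', b.1.vert i h h' = p i (alternate σ x i)) hjl
    (fun _ _ => h0) (fun _ _ => h1) (fun i h h' ih ih' _ _ => by
      have hi : i < l := i.lt_succ_self.trans h'
      have hs := (b.1.source_edge i h hi).trans (ih _ _)
      have hs' := (b.1.source_edge (i + 1) (h.trans i.le_succ) h').trans
        (ih' (h.trans (by omega)) h')
      rw [← b.1.range_edge i h hi]
      rcases Nat.even_or_odd i with he | ho
      · rw [alternate_even _ _ he]
        rw [alternate_even _ _ (by grind)] at hs'
        exact hF.r_of_mem_R (hk.trans h) hp he (b.2.1 i h hi) (b.2.2 i h h' he) hs'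
      · rw [alternate_odd _ _ ho]
        rw [alternate_even _ _ ho.add_one] at hs
        exact hF.r_of_red_odd (hk.trans h) hp ho (b.2.1 i h hi) hs)
  exact fun i h h' => this i h h' h h'

theorem vert_redPath_of_even (hF : F.Represents σ k p) (hp : IsLabelling σ k p) {j l : ℕ}
    (hk : k ≤ j) (hjl : j < l) (hl : Even l) (b : F.RedPath j l) {x : X}
    (h0 : b.1.vert l hjl.le le_rfl = p l x) :
    ∀ i h h', b.1.vert i h h' = p i (alternate σ x i) := by
  refine hF.vert_redPath hp hk hjl b (by rwa [alternate_even _ _ hl]) ?_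
  obtain ⟨l, rfl⟩ : ∃ n, l = n + 1 := ⟨l - 1, by omega⟩
  have ho : Odd l := by grind
  have hjl' : j ≤ l := Nat.le_of_lt_succ hjl
  change b.1.vert l hjl' l.le_succ = p l (alternate σ x l)
  rw [alternate_odd _ _ ho, ← b.1.range_edge l hjl' l.lt_succ_self]
  exact hF.r_of_red_odd (hk.trans hjl') hp ho (b.2.1 _ _ _)
    ((b.1.source_edge l hjl' l.lt_succ_self).trans h0)

theorem vert_redPath_of_odd (hF : F.Represents σ k p) (hp : IsLabelling σ k p) {j l : ℕ}
    (hk : k ≤ j) (hjl : j < l) (hl : Odd l) (b : F.RedPath j l) {y : X}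
    (h0 : b.1.vert l hjl.le le_rfl = p l y) :
    ∃ x, σ x = y ∧ ∀ i h h', b.1.vert i h h' = p i (alternate σ x i) := by
  obtain ⟨l, rfl⟩ : ∃ n, l = n + 1 := ⟨l - 1, by omega⟩
  have he : Even l := by grind
  have hjl' : j ≤ l := Nat.le_of_lt_succ hjl
  obtain ⟨x, hx, hxr⟩ := hF.exists_of_red_even (hk.trans hjl') hp he (b.2.1 l hjl' l.lt_succ_self)
    ((b.1.source_edge l hjl' l.lt_succ_self).trans h0)
  refine ⟨x, hx, hF.vert_redPath hp hk hjl b (by rwa [alternate_odd _ _ hl, hx]) ?_⟩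
  change b.1.vert l hjl' l.le_succ = p l (alternate σ x l)
  rw [alternate_even _ _ he, hxr, b.1.range_edge]

theorem exists_vert_redPath (hF : F.Represents σ k p) (hp : IsLabelling σ k p) {j l : ℕ}
    (hk : k ≤ j) (hjl : j < l) (b : F.RedPath j l) :
    ∃ x, ∀ i h h', b.1.vert i h h' = p i (alternate σ x i) := by
  obtain ⟨x, hx⟩ := hF.surj l (b.1.vert l hjl.le le_rfl)
  rcases Nat.even_or_odd l with hl | hl
  · exact ⟨x, hF.vert_redPath_of_even hp hk hjl hl b hx.symm⟩
  · obtain ⟨x', -, h⟩ := hF.vert_redPath_of_odd hp hk hjl hl b hx.symm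
    exact ⟨x', h⟩

omit [TopologicalSpace X] in
theorem exists_redPath (hF : F.Represents σ k p) (j l : ℕ) (hk : k ≤ j) (x : X) :
    ∃ b : F.RedPath j l, ∀ i h h', b.1.vert i h h' = p i (alternate σ x i) := by
  choose e he using fun i (h : k ≤ i) => (hF.red_iff i h _ _).2 ⟨x, rfl, rfl⟩
  refine ⟨⟨⟨fun i _ _ => p i (alternate σ x i), fun i h _ => e i (hk.trans h),
    fun i h _ => (he i _).2.2, fun i h _ => (he i _).2.1⟩, fun i h _ => (he i _).1,
    fun i h _ hi => ?_⟩, fun _ _ _ => rfl⟩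
  refine hF.mem_R_of (hk.trans h) (x := x) hi (he i _).1 (he (i + 1) _).1
    ((he (i + 1) _).2.2.trans (he i _).2.1.symm) ((he (i + 1) _).2.1.trans ?_)
    ((he i _).2.2.trans ?_)
  · rw [alternate_even _ _ (by grind)]
  · rw [alternate_even _ _ hi]

/-- A contraction of a represented diagram is represented by the corresponding subsequence of the
labelling. -/
theorem contract (hF : F.Represents σ k p) (hp : IsLabelling σ k p) {m : ℕ → ℕ}
    (hm : IsContractionSeq m) (hk : k ≤ m 0) :
    (F.contract m hm.1).Represents σ 0 fun n => p (m n) := by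
  have hkn : ∀ n, k ≤ m n := fun n => hk.trans (hm.1.monotone n.zero_le)
  have hlt : ∀ n, m n < m (n + 1) := fun n => hm.1 n.lt_succ_self
  have hev := hm.even_iff
  have hod : ∀ n, Odd (m n) ↔ Odd n := fun n => by
    rw [← Nat.not_even_iff_odd, ← Nat.not_even_iff_odd, hev]
  have halt : ∀ x n, alternate σ x (m n) = alternate σ x n := fun x n => by
    simp only [alternate, hev]
  have red_of : ∀ {n : ℕ} (f : (F.contract m hm.1).E n), f ∈ (F.contract m hm.1).red →
      ∃ b : F.RedPath (m n) (m (n + 1)), f = Sum.inr b := by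
    rintro n (b | b) hf
    · exact absurd ⟨b, rfl⟩ hf
    · exact ⟨b, rfl⟩
  have inr_red : ∀ {n : ℕ} (b : F.RedPath (m n) (m (n + 1))),
      (Sum.inr b : (F.contract m hm.1).E n) ∈ (F.contract m hm.1).red := by
    rintro n b ⟨c, hc⟩
    cases hc
  refine
    { surj := fun n => hF.surj (m n)
      blue_iff := fun n _ w v => ⟨?_, ?_⟩
      blue_ext := ?_
      red_iff := fun n _ w v => ⟨?_, ?_⟩
      red_ext := ?_
      R_iff := ?_ }
  · rintro ⟨_, ⟨b, rfl⟩, rfl, rfl⟩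
    obtain ⟨x, hx⟩ := hF.surj _ (b.1.vert (m (n + 1)) (hlt n).le le_rfl)
    exact ⟨x, hx, (hF.vert_bluePath hp (hkn n) (hlt n).le b hx _ _ _).symm⟩
  · rintro ⟨x, rfl, rfl⟩
    obtain ⟨b, hb⟩ := hF.exists_bluePath (m n) (m (n + 1)) (hkn n) x
    exact ⟨Sum.inl b, ⟨b, rfl⟩, hb _ _ _, hb _ _ _⟩
  · rintro n - _ _ ⟨b, rfl⟩ ⟨c, rfl⟩ hs -
    change b.1.vert (m (n + 1)) (hlt n).le le_rfl = c.1.vert (m (n + 1)) (hlt n).le le_rfl at hs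
    obtain ⟨x, hx⟩ := hF.surj _ (b.1.vert (m (n + 1)) (hlt n).le le_rfl)
    have hb := hF.vert_bluePath hp (hkn n) (hlt n).le b hx
    have hc := hF.vert_bluePath hp (hkn n) (hlt n).le c (hx.trans hs)
    refine congrArg Sum.inl (Subtype.ext (FinPath.ext' (fun i h h' => by rw [hb, hc]) ?_))
    intro i h h'
    refine hF.blue_ext' ((hkn n).trans h) hp (b.2 _ _ _) (c.2 _ _ _) ?_
    rw [FinPath.source_edge, FinPath.source_edge, hb, hc]
  · rintro ⟨f, hf, rfl, rfl⟩
    obtain ⟨b, rfl⟩ := red_of f hf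
    obtain ⟨x, hx⟩ := hF.exists_vert_redPath hp (hkn n) (hlt n) b
    refine ⟨x, ?_, ?_⟩
    · rw [← halt]
      exact (hx _ _ _).symm
    · rw [← halt]
      exact (hx _ _ _).symm
  · rintro ⟨x, rfl, rfl⟩
    obtain ⟨b, hb⟩ := hF.exists_redPath (m n) (m (n + 1)) (hkn n) x
    refine ⟨Sum.inr b, inr_red b, ?_, ?_⟩
    · rw [← halt]
      exact hb _ _ _
    · rw [← halt]
      exact hb _ _ _
  · intro n _ f f' hf hf' hs hr
    obtain ⟨b, rfl⟩ := red_of f hf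
    obtain ⟨c, rfl⟩ := red_of f' hf'
    change b.1.vert (m (n + 1)) (hlt n).le le_rfl = c.1.vert (m (n + 1)) (hlt n).le le_rfl at hs
    change b.1.vert (m n) le_rfl (hlt n).le = c.1.vert (m n) le_rfl (hlt n).le at hr
    have key : ∃ x, (∀ i h h', b.1.vert i h h' = p i (alternate σ x i)) ∧
        ∀ i h h', c.1.vert i h h' = p i (alternate σ x i) := by
      obtain ⟨x, hx⟩ := hF.surj _ (b.1.vert (m (n + 1)) (hlt n).le le_rfl)
      rcases Nat.even_or_odd n with hn | hn
      · -- The two paths come from preimages of one point in the set of the common range, on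
        -- which `σ` is injective.
        have hl : Odd (m (n + 1)) := (hod _).2 hn.add_one
        obtain ⟨y, hy, hb⟩ := hF.vert_redPath_of_odd hp (hkn n) (hlt n) hl b hx.symm
        obtain ⟨y', hy', hc⟩ := hF.vert_redPath_of_odd hp (hkn n) (hlt n) hl c (hs.symm.trans hx.symm)
        have h1 := hb (m n) le_rfl (hlt n).le
        have h2 := hc (m n) le_rfl (hlt n).le
        rw [halt, alternate_even _ _ hn] at h1 h2
        obtain rfl : y = y' := hp.inj_of_le (hkn n) (h1.symm.trans (hr.trans h2)) (hy.trans hy'.symm)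
        exact ⟨y, hb, hc⟩
      · have hl : Even (m (n + 1)) := (hev _).2 hn.add_one
        exact ⟨x, hF.vert_redPath_of_even hp (hkn n) (hlt n) hl b hx.symm,
          hF.vert_redPath_of_even hp (hkn n) (hlt n) hl c (hs.symm.trans hx.symm)⟩
    obtain ⟨x, hb, hc⟩ := key
    refine congrArg Sum.inr (Subtype.ext (FinPath.ext' (fun i h h' => by rw [hb, hc]) ?_))
    intro i h h'
    refine hF.red_ext _ ((hkn n).trans h) _ _ (b.2.1 _ _ _) (c.2.1 _ _ _) ?_ ?_
    · rw [FinPath.source_edge, FinPath.source_edge, hb, hc]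
    · rw [FinPath.range_edge, FinPath.range_edge, hb, hc]
  · intro n _ hn f g hf
    obtain ⟨b, rfl⟩ := red_of f hf
    have hn1 : Odd (m (n + 1)) := (hod _).2 hn.add_one
    have hn2 : Even (m (n + 2)) := (hev _).2 (by grind)
    -- The last edge of a path of layer `n` belongs to the even layer `i`.
    obtain ⟨i, hi⟩ : ∃ i, i + 1 = m (n + 1) := ⟨m (n + 1) - 1, by have := hlt n; omega⟩
    have hie : Even i := by grind
    have hji : m n ≤ i := Nat.le_of_lt_succ ((hlt n).trans_eq hi.symm)
    have hil : i < m (n + 1) := i.lt_succ_self.trans_eq hi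
    have hil' : i + 1 < m (n + 2) := hi.trans_lt (hlt (n + 1))
    have hki : k ≤ i := (hkn n).trans hji
    constructor
    · rintro ⟨c, rfl, hc⟩
      have hcR := hc i hi
      have hrs := ((hF.R_iff i hki hie _ _ (b.2.1 i hji hil)).1 hcR).2.1
      rw [FinPath.range_edge, FinPath.source_edge] at hrs
      obtain ⟨x, hx⟩ := hF.surj _ (c.1.vert (m (n + 2)) (hlt (n + 1)).le le_rfl)
      have hcv := hF.vert_redPath_of_even hp (hkn (n + 1)) (hlt (n + 1)) hn2 c hx.symm
      have hcs : F.s (c.1.edge (i + 1) hi.ge hil') = p (i + 2) x := by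
        rw [FinPath.source_edge, hcv, alternate_even _ _ (by grind)]
      have hbr := hF.r_of_mem_R hki hp hie (b.2.1 i hji hil) hcR hcs
      rw [FinPath.range_edge] at hbr
      refine ⟨inr_red c, ?_, x, hx, ?_⟩
      · change c.1.vert (m (n + 1)) le_rfl (hlt (n + 1)).le = b.1.vert (m (n + 1)) (hlt n).le le_rfl
        have : ∀ t (ht : i + 1 = t) h1 h2 h3 h4, c.1.vert t h1 h2 = b.1.vert t h3 h4 := by
          rintro _ rfl h1 h2 h3 h4
          exact hrs
        exact this _ hi _ _ _ _
      · change p (m n) x = b.1.vert (m n) le_rfl (hlt n).le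
        obtain ⟨y, hy⟩ := hF.exists_vert_redPath hp (hkn n) (hlt n) b
        rw [hy, halt, alternate_even _ _ hn]
        rw [hy, alternate_even _ _ hie] at hbr
        exact (hp.eq_of_le hji hbr).symm
    · rintro ⟨hg, hrs, x, hxs, hxr⟩
      obtain ⟨c, rfl⟩ := red_of g hg
      refine ⟨c, rfl, fun i' hi' => ?_⟩
      obtain rfl : i' = i := by omega
      change c.1.vert (m (n + 1)) le_rfl (hlt (n + 1)).le =
        b.1.vert (m (n + 1)) (hlt n).le le_rfl at hrs
      change p (m (n + 2)) x = c.1.vert (m (n + 2)) (hlt (n + 1)).le le_rfl at hxs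
      change p (m n) x = b.1.vert (m n) le_rfl (hlt n).le at hxr
      have hcv := hF.vert_redPath_of_even hp (hkn (n + 1)) (hlt (n + 1)) hn2 c hxs.symm
      have hcr := hcv (m (n + 1)) le_rfl (hlt (n + 1)).le
      rw [alternate_odd _ _ hn1] at hcr
      obtain ⟨x', hx', hbv⟩ := hF.vert_redPath_of_odd hp (hkn n) (hlt n) hn1 b (hrs.symm.trans hcr)
      have hxx : x' = x := by
        refine hp.inj_of_le (hkn n) ?_ hx'
        rw [hxr, hbv, halt, alternate_even _ _ hn]
      subst hxx
      refine hF.mem_R_of hki (x := x') hie (b.2.1 _ _ _) (c.2.1 _ _ _) ?_ ?_ ?_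
      · rw [FinPath.range_edge, FinPath.source_edge, hcv, hbv]
      · rw [FinPath.source_edge, hcv, alternate_even _ _ (by grind)]
      · rw [FinPath.range_edge, hbv, alternate_even _ _ hie]

end Represents
end ColoredDiagram

/-! ### Partitions and labellings -/

section Cells

variable {X : Type u}

/-- The member of a partition that contains a given point. -/
def cellOf (P : Set (Set X)) (x : X) : Set X := ⋃₀ {Z | Z ∈ P ∧ x ∈ Z}

/-- The partition into the fibres of a function. -/
def fibers {V : Type*} (p : X → V) : Set (Set X) := Set.range fun x => p ⁻¹' {p x}

theorem IsSetPartition.cellOf_eq {P : Set (Set X)} (hP : IsSetPartition P Set.univ) {Z : Set X}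
    (hZ : Z ∈ P) {x : X} (hx : x ∈ Z) : cellOf P x = Z := by
  apply Set.Subset.antisymm
  · rintro y ⟨W, ⟨hW, hxW⟩, hy⟩
    have : W = Z := by
      by_contra hne
      exact Set.disjoint_left.1 (hP.2.1 hW hZ hne) hxW hx
    exact this ▸ hy
  · exact fun y hy => ⟨Z, ⟨hZ, hx⟩, hy⟩

theorem IsSetPartition.exists_mem {P : Set (Set X)} (hP : IsSetPartition P Set.univ) (x : X) :
    ∃ Z ∈ P, x ∈ Z := by
  have h : x ∈ ⋃₀ P := hP.2.2 ▸ Set.mem_univ x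
  exact h

theorem IsSetPartition.cellOf_mem {P : Set (Set X)} (hP : IsSetPartition P Set.univ) (x : X) :
    cellOf P x ∈ P ∧ x ∈ cellOf P x := by
  obtain ⟨Z, hZ, hx⟩ := hP.exists_mem x
  rw [hP.cellOf_eq hZ hx]
  exact ⟨hZ, hx⟩

theorem IsSetPartition.cellOf_eq_iff {P : Set (Set X)} (hP : IsSetPartition P Set.univ) {x y : X} :
    cellOf P x = cellOf P y ↔ y ∈ cellOf P x :=
  ⟨fun h => h ▸ (hP.cellOf_mem y).2, fun h => (hP.cellOf_eq (hP.cellOf_mem x).1 h).symm⟩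

theorem isSetPartition_fibers {V : Type*} (p : X → V) : IsSetPartition (fibers p) Set.univ := by
  refine ⟨?_, ?_, Set.eq_univ_of_forall fun x => ⟨_, ⟨x, rfl⟩, rfl⟩⟩
  · rintro _ ⟨x, rfl⟩
    exact ⟨x, rfl⟩
  · rintro _ ⟨x, rfl⟩ _ ⟨y, rfl⟩ hne
    refine Set.disjoint_left.2 fun w (hx : p w = p x) (hy : p w = p y) => hne ?_
    simp only [← hx, ← hy]

theorem cellOf_fibers {V : Type*} (p : X → V) (x : X) : cellOf (fibers p) x = p ⁻¹' {p x} :=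
  (isSetPartition_fibers p).cellOf_eq ⟨x, rfl⟩ rfl

theorem cellOf_fibers_eq_iff {V : Type*} (p : X → V) (x y : X) :
    cellOf (fibers p) x = cellOf (fibers p) y ↔ p x = p y := by
  rw [(isSetPartition_fibers p).cellOf_eq_iff, cellOf_fibers]
  exact eq_comm

theorem isClopenPartition_fibers [TopologicalSpace X] [CompactSpace X] {V : Type*} {p : X → V}
    (hp : IsLocallyConstant p) : IsClopenPartition (fibers p) := by
  refine ⟨?_, ?_, isSetPartition_fibers p⟩
  · have h := hp.range_finite.image fun v => p ⁻¹' {v}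
    rwa [← Set.range_comp] at h
  · rintro _ ⟨x, rfl⟩
    exact hp.isClopen_preimage _

theorem IsClopenPartition.isLocallyConstant_cellOf [TopologicalSpace X] {P : Set (Set X)}
    (hP : IsClopenPartition P) : IsLocallyConstant (cellOf P) := by
  rw [IsLocallyConstant.iff_eventually_eq]
  intro x
  filter_upwards [(hP.2.1 _ (hP.2.2.cellOf_mem x).1).isOpen.mem_nhds (hP.2.2.cellOf_mem x).2]
    with y hy
  exact (hP.2.2.cellOf_eq_iff.2 hy).symm

theorem Coarser.cellOf_eq {P Q : Set (Set X)} (h : Coarser P Q) (hP : IsSetPartition P Set.univ)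
    (hQ : IsSetPartition Q Set.univ) {x y : X} (hxy : cellOf Q x = cellOf Q y) :
    cellOf P x = cellOf P y := by
  obtain ⟨Z, hZ, hs⟩ := h _ (hQ.cellOf_mem x).1
  rw [hP.cellOf_eq hZ (hs (hQ.cellOf_mem x).2),
    hP.cellOf_eq hZ (hs (hQ.cellOf_eq_iff.1 hxy))]

/-- A point in the images of `T.card` disjoint sets has at least `T.card` preimages. -/
theorem mem_manyPreimages (σ : X → X) (T : Finset (Set X))
    (hT : (T : Set (Set X)).PairwiseDisjoint id) {y : X} (hy : ∀ Z ∈ T, y ∈ σ '' Z) :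
    y ∈ manyPreimages σ T.card := by
  have : Nonempty X := ⟨y⟩
  choose! a ha using hy
  have hinj : Set.InjOn a T := by
    intro Z hZ W hW h
    by_contra hne
    exact Set.disjoint_left.1 (hT hZ hW hne) (ha Z hZ).1 (h ▸ (ha W hW).1)
  change (T.card : ℕ∞) ≤ _
  rw [← Set.encard_coe_eq_coe_finsetCard, ← hinj.encard_image]
  refine Set.encard_le_encard ?_
  rintro _ ⟨Z, hZ, rfl⟩
  exact (ha Z hZ).2

end Cells

/-! ### Refined sequences and labellings -/

section Refined

variable {X : Type u} [t : TopologicalSpace X] {σ : X → X}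

theorem IsRefinedSeq.isLabelling {P : ℕ → Set (Set X)} (hσ : IsLHomeo σ)
    (hP : IsRefinedSeq σ P) : IsLabelling σ 0 fun n => cellOf (P n) where
  locConst n := (hP.isPartition n).isLocallyConstant_cellOf
  coarser n x y h := (hP.coarser n).cellOf_eq (hP.isPartition n).2.2 (hP.isPartition _).2.2 h
  inj x y h hxy := by
    have hc := (hP.isPartition 0).2.2
    have hi := Set.injOn_iff_injective.2 (hP.restrict_homeo _ (hc.cellOf_mem x).1).injective
    exact hi (hc.cellOf_mem x).2 (hc.cellOf_eq_iff.1 h) hxy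
  even n _ hn x y h := by
    have hc := (hP.isPartition n).2.2
    have hc' := (hP.isPartition (n + 1)).2.2
    obtain ⟨W, ⟨-, Z, hZ, _, ⟨-, T, -, hTP, rfl⟩, rfl⟩, hW⟩ :=
      hP.refine_even n hn _ (hc'.cellOf_mem (σ x)).1
    have h1 := (hW (hc'.cellOf_mem (σ x)).2).2
    have h2 := (hW (hc'.cellOf_eq_iff.1 h)).2.1
    have hxT : cellOf (P n) x ∈ T := by
      by_contra hx
      refine h1.2 ?_
      classical
      rw [← Finset.card_insert_of_notMem hx]
      have hsub : ((insert (cellOf (P n) x) T : Finset (Set X)) : Set (Set X)) ⊆ P n := by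
        rw [Finset.coe_insert]
        exact Set.insert_subset (hc.cellOf_mem x).1 hTP
      refine mem_manyPreimages σ _ (hc.2.1.subset hsub) fun Z hZ => ?_
      rcases Finset.mem_insert.1 hZ with rfl | hZ
      · exact ⟨x, (hc.cellOf_mem x).2, rfl⟩
      · exact Set.mem_iInter₂.1 h1.1 Z hZ
    obtain ⟨x', hx', rfl⟩ := Set.mem_iInter₂.1 h2 _ hxT
    exact ⟨x', rfl, hc.cellOf_eq (hc.cellOf_mem x).1 hx'⟩
  odd n _ hn x y h := by
    have hc := (hP.isPartition n).2.2
    have hc' := (hP.isPartition (n + 1)).2.2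
    obtain ⟨W, ⟨-, Z, hZ, _, ⟨Z', hZ', rfl⟩, rfl⟩, hW⟩ :=
      hP.refine_odd n hn _ (hc'.cellOf_mem x).1
    rw [hc.cellOf_eq hZ' (hW (hc'.cellOf_mem x).2).2,
      hc.cellOf_eq hZ' (hW (hc'.cellOf_eq_iff.1 h)).2]
  separates x y h := by
    have := hσ.metrizable
    have hmem : ∀ n, ∀ Z ∈ P n, (x ∈ Z ↔ y ∈ Z) := by
      intro n Z hZ
      have hc := (hP.isPartition n).2.2
      constructor
      · intro hx
        rw [← hc.cellOf_eq hZ hx]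
        exact hc.cellOf_eq_iff.1 (h n)
      · intro hy
        rw [← hc.cellOf_eq hZ hy]
        exact hc.cellOf_eq_iff.1 (h n).symm
    have hgen : ∀ U, TopologicalSpace.GenerateOpen (⋃ n, P n) U → (x ∈ U ↔ y ∈ U) := by
      intro U hU
      induction hU with
      | basic U hU =>
        obtain ⟨n, hn⟩ := Set.mem_iUnion.1 hU
        exact hmem n U hn
      | univ => exact Iff.rfl
      | inter U V _ _ ihU ihV => exact and_congr ihU ihV
      | sUnion S _ ih =>
        simp only [Set.mem_sUnion]
        exact exists_congr fun U => and_congr_right fun hU => ih U hU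
    refine (inseparable_iff_forall_isOpen.2 fun U hU => hgen U ?_).eq
    have hU' : @IsOpen X (TopologicalSpace.generateFrom (⋃ n, P n)) U := by
      rw [← hP.generates]
      exact hU
    exact hU'

theorem IsLabelling.isRefinedSeq {V : ℕ → Type*} {p : ∀ n, X → V n} (hσ : IsLHomeo σ)
    (hp : IsLabelling σ 0 p) : IsRefinedSeq σ fun n => fibers (p n) := by
  have := hσ.compact
  have := hσ.metrizable
  have := hσ.nonempty
  have hpart : ∀ n, IsClopenPartition (fibers (p n)) := fun n =>
    isClopenPartition_fibers (hp.locConst n)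
  have hcont : Continuous σ := hσ.isLocalHomeomorph.continuous
  refine
    { isPartition := hpart
      restrict_homeo := ?_
      coarser := ?_
      generates := ?_
      diam := ?_
      refine_even := ?_
      refine_odd := ?_ }
  · rintro Z hZ
    have hZc : CompactSpace Z :=
      isCompact_iff_compactSpace.1 ((hpart 0).2.1 Z hZ).isClosed.isCompact
    obtain ⟨x, rfl⟩ := hZ
    refine ((hcont.comp continuous_subtype_val).isClosedEmbedding ?_).isEmbedding
    rintro ⟨a, ha⟩ ⟨b, hb⟩ hab
    have ha' : p 0 a = p 0 x := ha
    have hb' : p 0 b = p 0 x := hb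
    exact Subtype.ext (hp.inj a b (ha'.trans hb'.symm) hab)
  · rintro n _ ⟨x, rfl⟩
    exact ⟨_, ⟨x, rfl⟩, fun y hy => hp.coarser n y x hy⟩
  · refine le_antisymm (le_generateFrom fun Z hZ => ?_) fun U hU => ?_
    · obtain ⟨n, hn⟩ := Set.mem_iUnion.1 hZ
      exact ((hpart n).2.1 Z hn).isOpen
    · -- Every point of an open set `U` has a member of some partition around it inside `U`.
      have key : ∀ x : U, ∃ n, p n ⁻¹' {p n x} ⊆ U := by
        rintro ⟨x, hx⟩
        have hC : IsClosed ({x} ×ˢ Uᶜ : Set (X × X)) := isClosed_singleton.prod hU.isClosed_compl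
        obtain ⟨N, hN⟩ := hp.eventually_notMem hC (by rintro y ⟨rfl, h⟩; exact h hx)
        refine ⟨N, fun y hy => ?_⟩
        by_contra hyU
        exact hN N le_rfl x y (Eq.symm hy) ⟨rfl, hyU⟩
      choose n hn using key
      have hUe : U = ⋃₀ Set.range fun x : U => p (n x) ⁻¹' {p (n x) x} := by
        apply Set.Subset.antisymm
        · exact fun x hx => ⟨_, ⟨⟨x, hx⟩, rfl⟩, rfl⟩
        · rintro y ⟨_, ⟨x, rfl⟩, hy⟩
          exact hn x hy
      rw [hUe]
      refine TopologicalSpace.GenerateOpen.sUnion _ ?_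
      rintro _ ⟨x, rfl⟩
      exact TopologicalSpace.GenerateOpen.basic _ (Set.mem_iUnion.2 ⟨n x, x, rfl⟩)
  · let d : MetricSpace X := TopologicalSpace.metrizableSpaceMetric X
    refine ⟨d, rfl, ?_⟩
    rw [Metric.tendsto_atTop]
    intro ε hε
    have hC : IsClosed {z : X × X | ε / 2 ≤ dist z.1 z.2} :=
      isClosed_le continuous_const continuous_dist
    obtain ⟨N, hN⟩ := hp.eventually_notMem hC (fun x hx => by
      have h : ε / 2 ≤ dist x x := hx
      rw [dist_self] at h
      linarith)
    refine ⟨N, fun n hn => ?_⟩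
    have h1 : 0 ≤ partitionDiam d (fibers (p n)) := by
      refine Real.sSup_nonneg ?_
      rintro _ ⟨Z, -, rfl⟩
      exact Metric.diam_nonneg
    have h2 : partitionDiam d (fibers (p n)) ≤ ε / 2 := by
      refine Real.sSup_le ?_ (by linarith)
      rintro _ ⟨_, ⟨x, rfl⟩, rfl⟩
      refine Metric.diam_le_of_forall_dist_le (by linarith) fun a ha b hb => ?_
      have ha' : p n a = p n x := ha
      have hb' : p n b = p n x := hb
      have h : ¬ ε / 2 ≤ dist a b := hN n hn a b (ha'.trans hb'.symm)
      linarith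
    rw [Real.dist_eq, sub_zero, abs_of_nonneg h1]
    linarith
  · rintro n hn _ ⟨y, rfl⟩
    have hfin : {Z | Z ∈ fibers (p n) ∧ y ∈ σ '' Z}.Finite :=
      (hpart n).1.subset fun Z hZ => hZ.1
    have hmem : ∀ Z, Z ∈ hfin.toFinset ↔ Z ∈ fibers (p n) ∧ y ∈ σ '' Z := fun Z =>
      hfin.mem_toFinset
    -- All points of the member of `y` lie in the images of the same members of the partition `n`.
    have himg : ∀ y₁ y₂, p (n + 1) y₁ = p (n + 1) y₂ → ∀ Z ∈ fibers (p n), y₁ ∈ σ '' Z →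
        y₂ ∈ σ '' Z := by
      rintro y₁ y₂ h _ ⟨x, rfl⟩ ⟨x₁, hx₁, rfl⟩
      obtain ⟨x₂, h2, h3⟩ := hp.even n n.zero_le hn x₁ y₂ h
      exact ⟨x₂, h3.trans hx₁, h2⟩
    have hsub : p (n + 1) ⁻¹' {p (n + 1) y} ⊆ (⋂ Z ∈ hfin.toFinset, σ '' Z) \
        manyPreimages σ (hfin.toFinset.card + 1) := by
      intro w hw
      have hw' : p (n + 1) w = p (n + 1) y := hw
      refine ⟨Set.mem_iInter₂.2 fun Z hZ => ?_, fun hmany => ?_⟩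
      · exact himg y w hw'.symm Z ((hmem Z).1 hZ).1 ((hmem Z).1 hZ).2
      · have hle : (σ ⁻¹' {w}).encard ≤ (hfin.toFinset : Set (Set X)).encard := by
          refine Set.encard_le_encard_of_injOn (f := fun x => p n ⁻¹' {p n x}) ?_ ?_
          · rintro x rfl
            exact (hmem _).2 ⟨⟨x, rfl⟩, himg _ y hw' _ ⟨x, rfl⟩ ⟨x, rfl, rfl⟩⟩
          · intro x hx x' hx' hxx
            have hx2 : x ∈ p n ⁻¹' {p n x'} := by
              rw [← show p n ⁻¹' {p n x} = p n ⁻¹' {p n x'} from hxx]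
              rfl
            exact hp.inj_of_le n.zero_le hx2 (Eq.trans hx (Eq.symm hx'))
        rw [Set.encard_coe_eq_coe_finsetCard] at hle
        have h2 : ((hfin.toFinset.card + 1 : ℕ) : ℕ∞) ≤ (hfin.toFinset.card : ℕ∞) :=
          le_trans hmany hle
        have h3 := Nat.cast_le.1 h2
        omega
    refine ⟨p n ⁻¹' {p n y} ∩ _, ⟨?_, _, ⟨y, rfl⟩, _, ⟨⟨y, hsub rfl⟩, hfin.toFinset, ?_, ?_, rfl⟩,
      rfl⟩, fun w hw => ⟨hp.coarser n w y hw, hsub hw⟩⟩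
    · exact ⟨y, rfl, hsub rfl⟩
    · obtain ⟨x, rfl⟩ := hσ.surjective y
      exact ⟨_, (hmem _).2 ⟨⟨x, rfl⟩, ⟨x, rfl, rfl⟩⟩⟩
    · exact fun Z hZ => ((hmem Z).1 hZ).1
  · rintro n hn _ ⟨x, rfl⟩
    refine ⟨p n ⁻¹' {p n x} ∩ σ ⁻¹' (p n ⁻¹' {p n (σ x)}), ⟨⟨x, rfl, rfl⟩, _, ⟨x, rfl⟩, _,
      ⟨_, ⟨σ x, rfl⟩, rfl⟩, rfl⟩, fun y hy => ⟨hp.coarser n y x hy, hp.odd n n.zero_le hn y x hy⟩⟩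

end Refined

/-! ### Existence of refined sequences -/

section Existence

variable {X : Type u} [TopologicalSpace X] {σ : X → X}

omit [TopologicalSpace X] in
theorem fiber_eq_iff {V : Type*} (f : X → V) (x y : X) :
    f ⁻¹' {f x} = f ⁻¹' {f y} ↔ f x = f y := by
  constructor
  · intro h
    have hx : x ∈ f ⁻¹' {f y} := h ▸ rfl
    exact hx
  · intro h
    rw [h]

theorem isLocallyConstant_fiber {V : Type*} {f : X → V} (hf : IsLocallyConstant f) :
    IsLocallyConstant fun x => f ⁻¹' {f x} := hf.comp fun v => f ⁻¹' {v}

/-- The step in the construction of a refined sequence: a partition that satisfies the conditions of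
both the even and the odd layers relative to `q` and does not cut the clopen set `U`. -/
theorem exists_refinement (hσ : IsLHomeo σ) {q : X → Set X} (hq : IsLocallyConstant q) {U : Set X}
    (hU : IsClopen U) : ∃ q' : X → Set X, IsLocallyConstant q' ∧ ∀ x y, q' x = q' y →
      q x = q y ∧ q (σ x) = q (σ y) ∧ (x ∈ U ↔ y ∈ U) ∧
      ∀ x', σ x' = x → ∃ y', σ y' = y ∧ q y' = q x' := by
  have := hσ.compact
  have := hσ.metrizable
  have hcont : Continuous σ := hσ.isLocalHomeomorph.continuous
  have himg : ∀ a, IsClopen (σ '' (q ⁻¹' {a})) := fun a =>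
    ⟨((hq.isClopen_preimage _).isClosed.isCompact.image hcont).isClosed,
      hσ.isLocalHomeomorph.isOpenMap _ (hq _)⟩
  have hI : IsLocallyConstant fun x => {a | x ∈ σ '' (q ⁻¹' {a})} := by
    rw [IsLocallyConstant.iff_eventually_eq]
    intro x
    have h : ∀ᶠ y in nhds x, ∀ a ∈ Set.range q,
        (y ∈ σ '' (q ⁻¹' {a}) ↔ x ∈ σ '' (q ⁻¹' {a})) := by
      rw [Filter.eventually_all_finite hq.range_finite]
      intro a _
      by_cases hx : x ∈ σ '' (q ⁻¹' {a})
      · filter_upwards [(himg a).isOpen.mem_nhds hx] with y hy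
        exact iff_of_true hy hx
      · filter_upwards [(himg a).compl.isOpen.mem_nhds hx] with y hy
        exact iff_of_false hy hx
    filter_upwards [h] with y hy
    ext a
    by_cases ha : a ∈ Set.range q
    · exact hy a ha
    · refine iff_of_false ?_ ?_ <;>
      · rintro ⟨z, hz, -⟩
        exact ha ⟨z, hz⟩
  have hUc : IsLocallyConstant fun x => x ∈ U := by
    rw [IsLocallyConstant.iff_eventually_eq]
    intro x
    by_cases hx : x ∈ U
    · filter_upwards [hU.isOpen.mem_nhds hx] with y hy
      exact propext (iff_of_true hy hx)
    · filter_upwards [hU.compl.isOpen.mem_nhds hx] with y hy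
      exact propext (iff_of_false hy hx)
  refine ⟨_, isLocallyConstant_fiber
    ((hq.prodMk (hq.comp_continuous hcont)).prodMk (hUc.prodMk hI)), fun x y hxy => ?_⟩
  rw [fiber_eq_iff] at hxy
  simp only [Prod.mk.injEq] at hxy
  obtain ⟨⟨h1, h2⟩, h3, h4⟩ := hxy
  refine ⟨h1, h2, iff_of_eq h3, ?_⟩
  rintro x' rfl
  have : q x' ∈ {a | y ∈ σ '' (q ⁻¹' {a})} := h4 ▸ ⟨x', rfl, rfl⟩
  obtain ⟨y', hy', hy⟩ := this
  exact ⟨y', hy, hy'⟩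

theorem exists_isLocallyConstant_injOn (hσ : IsLHomeo σ) : ∃ q : X → Set X, IsLocallyConstant q ∧
    ∀ x y, q x = q y → σ x = σ y → x = y := by
  have := hσ.compact
  have := hσ.metrizable
  have := hσ.totallyDisconnected
  have h : ∀ x : X, ∃ U : Set X, IsClopen U ∧ x ∈ U ∧ Set.InjOn σ U := by
    intro x
    obtain ⟨φ, hx, hφ⟩ := hσ.isLocalHomeomorph x
    obtain ⟨U, hU, hxU, hUs⟩ := compact_exists_isClopen_in_isOpen φ.open_source hx
    exact ⟨U, hU, hxU, hφ ▸ φ.injOn.mono hUs⟩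
  choose U hU hxU hinj using h
  obtain ⟨T, -, hT⟩ := isCompact_univ.elim_nhds_subcover U
    fun x _ => (hU x).isOpen.mem_nhds (hxU x)
  refine ⟨fun x => {i | i ∈ T ∧ x ∈ U i}, ?_, fun x y hxy => ?_⟩
  · rw [IsLocallyConstant.iff_eventually_eq]
    intro x
    have h : ∀ᶠ y in nhds x, ∀ i ∈ T, (y ∈ U i ↔ x ∈ U i) := by
      rw [Filter.eventually_all_finset]
      intro i _
      by_cases hx : x ∈ U i
      · filter_upwards [(hU i).isOpen.mem_nhds hx] with y hy
        exact iff_of_true hy hx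
      · filter_upwards [(hU i).compl.isOpen.mem_nhds hx] with y hy
        exact iff_of_false hy hx
    filter_upwards [h] with y hy
    ext i
    exact and_congr_right (hy i)
  · obtain ⟨i, hi, hx⟩ := Set.mem_iUnion₂.1 (hT (Set.mem_univ x))
    have hxy' : {i | i ∈ T ∧ x ∈ U i} = {i | i ∈ T ∧ y ∈ U i} := hxy
    have hy : i ∈ {i | i ∈ T ∧ y ∈ U i} := by
      rw [← hxy']
      exact ⟨hi, hx⟩
    exact hinj i hx hy.2

theorem exists_isLabelling (hσ : IsLHomeo σ) : ∃ p : ℕ → X → Set X, IsLabelling σ 0 p := by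
  have := hσ.compact
  have := hσ.metrizable
  have := hσ.totallyDisconnected
  have : SecondCountableTopology X := by
    let _ := TopologicalSpace.metrizableSpaceMetric X
    infer_instance
  have : Countable (TopologicalSpace.Clopens X) :=
    TopologicalSpace.Clopens.countable_iff_secondCountable.2 this
  obtain ⟨U, hU⟩ := exists_surjective_nat (TopologicalSpace.Clopens X)
  choose S hS hS' using fun (q : {q : X → Set X // IsLocallyConstant q}) (n : ℕ) =>
    exists_refinement hσ q.2 (U n).isClopen
  obtain ⟨q₀, hq₀, hinj⟩ := exists_isLocallyConstant_injOn hσ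
  let p : ℕ → {q : X → Set X // IsLocallyConstant q} :=
    fun n => Nat.rec ⟨q₀, hq₀⟩ (fun n q => ⟨S q n, hS q n⟩) n
  have hp : ∀ n x y, (p (n + 1)).1 x = (p (n + 1)).1 y → _ := fun n => hS' (p n) n
  refine ⟨fun n => (p n).1, ?_⟩
  refine
    { locConst := fun n => (p n).2
      coarser := fun n x y h => (hp n x y h).1
      inj := hinj
      even := fun n _ _ x y h => (hp n _ _ h).2.2.2 x rfl
      odd := fun n _ _ x y h => (hp n _ _ h).2.1
      separates := fun x y h => ?_ }
  by_contra hne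
  obtain ⟨W, hW, hx, hy⟩ := compact_exists_isClopen_in_isOpen (isOpen_compl_singleton (x := y))
    (show x ∈ ({y}ᶜ : Set X) from hne)
  obtain ⟨n, hn⟩ := hU ⟨W, hW⟩
  have h1 := (hp n x y (h (n + 1))).2.2.1
  rw [hn] at h1
  exact hy (h1.1 hx) rfl

theorem exists_isRefinedSeq (hσ : IsLHomeo σ) : ∃ P : ℕ → Set (Set X), IsRefinedSeq σ P := by
  obtain ⟨p, hp⟩ := exists_isLabelling hσ
  exact ⟨_, hp.isRefinedSeq hσ⟩

end Existence

/-! ### The diagram of a refined sequence -/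

section DiagramOf

variable {X : Type u} [TopologicalSpace X] {σ : X → X} {P : ℕ → Set (Set X)}

/-- The labelling of the points by the vertices of the diagram of a sequence of partitions. -/
def cellLabel (hP : ∀ n, IsClopenPartition (P n)) (n : ℕ) (x : X) : (diagramOf σ P).V n :=
  ⟨cellOf (P n) x, ((hP n).2.2.cellOf_mem x).1⟩

theorem cellLabel_eq_iff (hP : ∀ n, IsClopenPartition (P n)) {n : ℕ} {x : X}
    {v : (diagramOf σ P).V n} : cellLabel hP n x = v ↔ x ∈ v.1 := by
  refine Subtype.ext_iff.trans ⟨fun h => ?_, fun h => (hP n).2.2.cellOf_eq v.2 h⟩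
  rw [← h]
  exact ((hP n).2.2.cellOf_mem x).2

theorem isLabelling_cellLabel (hP : ∀ n, IsClopenPartition (P n))
    (hp : IsLabelling σ 0 fun n => cellOf (P n)) :
    IsLabelling σ 0 (V := (diagramOf σ P).V) (cellLabel hP) :=
  hp.of_ker_eq _ fun _ _ _ => Subtype.ext_iff

theorem subset_iff_exists (hP : ∀ n, IsClopenPartition (P n))
    (hp : IsLabelling σ 0 fun n => cellOf (P n)) {m n : ℕ} (hmn : m ≤ n)
    (w : (diagramOf σ P).V n) (v : (diagramOf σ P).V m) :
    w.1 ⊆ v.1 ↔ ∃ x, cellLabel (σ := σ) hP n x = w ∧ cellLabel (σ := σ) hP m x = v := by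
  simp only [cellLabel_eq_iff]
  constructor
  · intro h
    obtain ⟨x, hx⟩ := (hP n).2.2.1 w.1 w.2
    exact ⟨x, hx, h hx⟩
  · rintro ⟨x, hw, hv⟩ y hy
    have h := (isLabelling_cellLabel hP hp).eq_of_le hmn (x := y) (y := x)
      (by rw [(cellLabel_eq_iff hP).2 hy, (cellLabel_eq_iff hP).2 hw])
    exact (cellLabel_eq_iff hP).1 (h.trans ((cellLabel_eq_iff hP).2 hv))

theorem redRel_iff_exists (hP : ∀ n, IsClopenPartition (P n))
    (hp : IsLabelling σ 0 fun n => cellOf (P n)) {n : ℕ}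
    (w : (diagramOf σ P).V (n + 1)) (v : (diagramOf σ P).V n) :
    RedRel σ n w.1 v.1 ↔ ∃ x, cellLabel (σ := σ) hP (n + 1) (alternate σ x (n + 1)) = w ∧
      cellLabel (σ := σ) hP n (alternate σ x n) = v := by
  have hl := isLabelling_cellLabel hP hp
  obtain ⟨z, hz⟩ := (hP (n + 1)).2.2.1 w.1 w.2
  rcases Nat.even_or_odd n with hn | hn
  · have hn' := Nat.not_odd_iff_even.2 hn
    simp only [RedRel, hn, hn', true_and, false_and, or_false, alternate_even _ _ hn,
      alternate_odd _ _ hn.add_one, cellLabel_eq_iff]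
    constructor
    · intro h
      obtain ⟨x, hx, rfl⟩ := h hz
      exact ⟨x, hz, hx⟩
    · rintro ⟨x, hw, hv⟩ y hy
      obtain ⟨x', rfl, h⟩ := hl.even n n.zero_le hn x y
        (by rw [(cellLabel_eq_iff hP).2 hy, (cellLabel_eq_iff hP).2 hw])
      exact ⟨x', (cellLabel_eq_iff hP).1 (h.trans ((cellLabel_eq_iff hP).2 hv)), rfl⟩
  · have hn' := Nat.not_even_iff_odd.2 hn
    simp only [RedRel, hn, hn', true_and, false_and, false_or, alternate_odd _ _ hn,
      alternate_even _ _ hn.add_one, cellLabel_eq_iff]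
    constructor
    · exact fun h => ⟨z, hz, h hz⟩
    · rintro ⟨x, hw, hv⟩ y hy
      have h := hl.odd n n.zero_le hn y x
        (by rw [(cellLabel_eq_iff hP).2 hy, (cellLabel_eq_iff hP).2 hw])
      exact (cellLabel_eq_iff hP).1 (h.trans ((cellLabel_eq_iff hP).2 hv))

theorem represents_diagramOf (hP : ∀ n, IsClopenPartition (P n))
    (hp : IsLabelling σ 0 fun n => cellOf (P n)) :
    (diagramOf σ P).Represents σ 0 (cellLabel hP) where
  surj n v := by
    obtain ⟨x, hx⟩ := (hP n).2.2.1 v.1 v.2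
    exact ⟨x, (cellLabel_eq_iff hP).2 hx⟩
  blue_iff n _ w v := by
    rw [← subset_iff_exists hP hp n.le_succ]
    constructor
    · rintro ⟨_, ⟨e, rfl⟩, rfl, rfl⟩
      exact e.2
    · exact fun h => ⟨Sum.inl ⟨(w, v), h⟩, ⟨_, rfl⟩, rfl, rfl⟩
  blue_ext := by
    rintro n - _ _ ⟨e, rfl⟩ ⟨e', rfl⟩ hs hr
    exact congrArg Sum.inl (Subtype.ext (Prod.ext hs hr))
  red_iff n _ w v := by
    rw [← redRel_iff_exists hP hp]
    constructor
    · rintro ⟨e | e, he, rfl, rfl⟩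
      · exact absurd ⟨e, rfl⟩ he
      · exact e.2
    · exact fun h => ⟨Sum.inr ⟨(w, v), h⟩, (by rintro ⟨_, h'⟩; cases h'), rfl, rfl⟩
  red_ext := by
    rintro n - (e | e) (e' | e') he he' hs hr
    · exact absurd ⟨e, rfl⟩ he
    · exact absurd ⟨e, rfl⟩ he
    · exact absurd ⟨e', rfl⟩ he'
    · exact congrArg Sum.inr (Subtype.ext (Prod.ext hs hr))
  R_iff n _ _ f g _ := by
    rw [← subset_iff_exists hP hp (by omega)]
    exact Iff.rfl

omit [TopologicalSpace X] in
theorem hasColorSep_diagramOf (σ : X → X) (P : ℕ → Set (Set X)) : (diagramOf σ P).HasColorSep :=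
  ColoredDiagram.hasColorSep_of_eq fun _ _ => rfl

theorem isLDiagram_diagramOf (hσ : IsLHomeo σ) (hP : IsRefinedSeq σ P) :
    (diagramOf σ P).IsLDiagram := by
  have := hσ.compact
  have := hσ.nonempty
  exact (represents_diagramOf hP.isPartition (hP.isLabelling hσ)).isLDiagram
    (isLabelling_cellLabel hP.isPartition (hP.isLabelling hσ)) hσ.surjective
    (hasColorSep_diagramOf σ P)

end DiagramOf

/-! ### Diagrams of the same system are equivalent -/

section Mixing

open ColoredDiagram

variable {X : Type u} [TopologicalSpace X] {σ : X → X}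

theorem LDiag.equiv_of_iso {F G : LDiag.{u}} (h : F.1.Iso G.1) : F ≈ G :=
  Relation.EqvGen.rel _ _ (Or.inl h)

theorem LDiag.equiv_of_contracts {F G : LDiag.{u}} (h : F.Contracts G) : F ≈ G :=
  Relation.EqvGen.rel _ _ (Or.inr h)

/-- Two `l`-diagrams are equivalent if contractions of them are represented by the same partitions
of a system. -/
theorem LDiag.equiv_of_subsequences (hσ : IsLHomeo σ) {F G : LDiag.{u}} {k l : ℕ}
    {p : ∀ n, X → F.1.V n} {q : ∀ n, X → G.1.V n} (hF : F.1.Represents σ k p)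
    (hp : IsLabelling σ k p) (hG : G.1.Represents σ l q) (hq : IsLabelling σ l q) {a b : ℕ → ℕ}
    (ha : IsContractionSeq a) (hb : IsContractionSeq b) (hka : k ≤ a 0) (hlb : l ≤ b 0)
    (hab : ∀ n x y, p (a n) x = p (a n) y ↔ q (b n) x = q (b n) y) : F ≈ G := by
  have := hσ.compact
  have := hσ.nonempty
  have hF' := hF.contract hp ha hka
  have hG' := hG.contract hq hb hlb
  have h1 := hF'.isLDiagram (hp.comp_seq ha.1 ha.even_iff hka) hσ.surjective
    (hasColorSep_contract _ _ _)
  have h2 := hG'.isLDiagram (hq.comp_seq hb.1 hb.even_iff hlb) hσ.surjective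
    (hasColorSep_contract _ _ _)
  let F' : LDiag.{u} := ⟨_, h1⟩
  let G' : LDiag.{u} := ⟨_, h2⟩
  have e1 : F ≈ F' := LDiag.equiv_of_contracts ⟨a, ha, rfl⟩
  have e2 : G ≈ G' := LDiag.equiv_of_contracts ⟨b, hb, rfl⟩
  have e3 : F' ≈ G' := LDiag.equiv_of_iso
    (hF'.iso hG' hab (hasColorSep_contract _ _ _) (hasColorSep_contract _ _ _))
  exact Setoid.trans e1 (Setoid.trans e3 (Setoid.symm e2))

/-- A sequence `c` of layers of alternating parity that grows so fast that the layer `c (n + 1)` of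
either of two labellings refines the layer `c n + 1`, and hence the layer `c n`, of both. -/
theorem exists_interleaving [CompactSpace X] {V W : ℕ → Type*} {p : ∀ n, X → V n}
    {q : ∀ n, X → W n} (hp : IsLabelling σ 0 p) (hq : IsLabelling σ 0 q) :
    ∃ c : ℕ → ℕ, StrictMono c ∧ (∀ n, Even (c n) ↔ Even n) ∧
      ∀ n x y, (p (c (n + 1)) x = p (c (n + 1)) y ∨ q (c (n + 1)) x = q (c (n + 1)) y) →
        p (c n + 1) x = p (c n + 1) y ∧ q (c n + 1) x = q (c n + 1) y := by
  have key : ∀ i, ∃ N, ∀ n, N ≤ n → ∀ x y, (p n x = p n y ∨ q n x = q n y) →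
      p i x = p i y ∧ q i x = q i y := by
    intro i
    obtain ⟨A, hA⟩ := hp.eventually_finer (hq.locConst i)
    obtain ⟨B, hB⟩ := hq.eventually_finer (hp.locConst i)
    refine ⟨max i (max A B), fun n hn x y h => ?_⟩
    rcases h with h | h
    · exact ⟨hp.eq_of_le (by omega) h, hA n (by omega) x y h⟩
    · exact ⟨hB n (by omega) x y h, hq.eq_of_le (by omega) h⟩
  choose N hN using key
  let c : ℕ → ℕ := fun n => Nat.rec 0 (fun _ i => i + 1 + 2 * N (i + 1)) n
  have hc : ∀ n, c (n + 1) = c n + 1 + 2 * N (c n + 1) := fun n => rfl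
  refine ⟨c, strictMono_nat_of_lt_succ fun n => by rw [hc]; omega, fun n => ?_,
    fun n => hN (c n + 1) _ (by rw [hc]; omega)⟩
  induction n with
  | zero => exact Iff.rfl
  | succ n ih =>
    rw [hc]
    rw [Nat.even_iff, Nat.even_iff] at *
    omega

/-- The sequence that consists of the layers `c n` of one labelling for `n ∈ A` and of another
labelling for `n ∉ A`. -/
theorem isLabelling_mix {V W : ℕ → Type*} {p : ∀ n, X → V n}
    {q : ∀ n, X → W n} (hp : IsLabelling σ 0 p) (hq : IsLabelling σ 0 q) {c : ℕ → ℕ}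
    (hc : StrictMono c) (hpar : ∀ n, Even (c n) ↔ Even n)
    (hpq : ∀ n x y, (p (c (n + 1)) x = p (c (n + 1)) y ∨ q (c (n + 1)) x = q (c (n + 1)) y) →
        p (c n + 1) x = p (c n + 1) y ∧ q (c n + 1) x = q (c n + 1) y)
    (A : Set ℕ) {o : ℕ → X → Set X}
    (hA : ∀ n ∈ A, ∀ x y, o n x = o n y ↔ p (c n) x = p (c n) y)
    (hA' : ∀ n ∉ A, ∀ x y, o n x = o n y ↔ q (c n) x = q (c n) y)
    (hloc : ∀ n, IsLocallyConstant (o n)) : IsLabelling σ 0 o := by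
  have hsucc : ∀ n x y, o (n + 1) x = o (n + 1) y →
      p (c n + 1) x = p (c n + 1) y ∧ q (c n + 1) x = q (c n + 1) y := by
    intro n x y h
    by_cases hn : n + 1 ∈ A
    · exact hpq n x y (Or.inl ((hA _ hn x y).1 h))
    · exact hpq n x y (Or.inr ((hA' _ hn x y).1 h))
  have hodd : ∀ n, Odd (c n) ↔ Odd n := fun n => by
    rw [← Nat.not_even_iff_odd, ← Nat.not_even_iff_odd, hpar]
  refine ⟨hloc, fun n x y h => ?_, fun x y h hσ => ?_, fun n _ hn x y h => ?_,
    fun n _ hn x y h => ?_, fun x y h => ?_⟩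
  · by_cases hn : n ∈ A
    · exact (hA n hn x y).2 (hp.coarser _ _ _ (hsucc n x y h).1)
    · exact (hA' n hn x y).2 (hq.coarser _ _ _ (hsucc n x y h).2)
  · by_cases hn : 0 ∈ A
    · exact hp.inj_of_le (Nat.zero_le _) ((hA 0 hn x y).1 h) hσ
    · exact hq.inj_of_le (Nat.zero_le _) ((hA' 0 hn x y).1 h) hσ
  · obtain ⟨h1, h2⟩ := hsucc n _ _ h
    by_cases hnA : n ∈ A
    · obtain ⟨x', h3, h4⟩ := hp.even _ (Nat.zero_le _) ((hpar n).2 hn) x y h1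
      exact ⟨x', h3, (hA n hnA _ _).2 h4⟩
    · obtain ⟨x', h3, h4⟩ := hq.even _ (Nat.zero_le _) ((hpar n).2 hn) x y h2
      exact ⟨x', h3, (hA' n hnA _ _).2 h4⟩
  · obtain ⟨h1, h2⟩ := hsucc n _ _ h
    by_cases hnA : n ∈ A
    · exact (hA n hnA _ _).2 (hp.odd _ (Nat.zero_le _) ((hodd n).2 hn) x y h1)
    · exact (hA' n hnA _ _).2 (hq.odd _ (Nat.zero_le _) ((hodd n).2 hn) x y h2)
  · exact hp.separates x y fun n =>
      hp.eq_of_le ((hc.id_le n).trans (Nat.le_succ _)) (hsucc n x y (h (n + 1))).1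

/-- Two `l`-diagrams that are represented by labellings of the same system are equivalent. -/
theorem LDiag.equiv_of_represents (hσ : IsLHomeo σ) {F G : LDiag.{u}} {p : ∀ n, X → F.1.V n}
    {q : ∀ n, X → G.1.V n} (hF : F.1.Represents σ 0 p) (hp : IsLabelling σ 0 p)
    (hG : G.1.Represents σ 0 q) (hq : IsLabelling σ 0 q) : F ≈ G := by
  classical
  have := hσ.compact
  obtain ⟨c, hc, hpar, hpq⟩ := exists_interleaving hp hq
  -- Consecutive terms of the two labellings, so that both subsequences can alternate in parity.
  let A : Set ℕ := {n | n % 4 = 0 ∨ n % 4 = 3}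
  let o : ℕ → X → Set X := fun n x =>
    if n ∈ A then p (c n) ⁻¹' {p (c n) x} else q (c n) ⁻¹' {q (c n) x}
  have ho : ∀ n ∈ A, o n = fun x => p (c n) ⁻¹' {p (c n) x} := fun n hn =>
    funext fun x => if_pos hn
  have ho' : ∀ n ∉ A, o n = fun x => q (c n) ⁻¹' {q (c n) x} := fun n hn =>
    funext fun x => if_neg hn
  have hA : ∀ n ∈ A, ∀ x y, o n x = o n y ↔ p (c n) x = p (c n) y := fun n hn x y => by
    rw [ho n hn]
    exact fiber_eq_iff _ x y
  have hA' : ∀ n ∉ A, ∀ x y, o n x = o n y ↔ q (c n) x = q (c n) y := fun n hn x y => by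
    rw [ho' n hn]
    exact fiber_eq_iff _ x y
  have hol : IsLabelling σ 0 o := by
    refine isLabelling_mix hp hq hc hpar hpq A hA hA' fun n => ?_
    by_cases hn : n ∈ A
    · rw [ho n hn]
      exact isLocallyConstant_fiber (hp.locConst _)
    · rw [ho' n hn]
      exact isLocallyConstant_fiber (hq.locConst _)
  have hP := hol.isRefinedSeq hσ
  have hP' := hP.isLabelling hσ
  let H : LDiag.{u} := ⟨_, isLDiagram_diagramOf hσ hP⟩
  have hH := represents_diagramOf hP.isPartition hP'
  have hHl := isLabelling_cellLabel hP.isPartition hP'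
  have hker : ∀ n x y, cellLabel (σ := σ) hP.isPartition n x = cellLabel hP.isPartition n y ↔
      o n x = o n y := fun n x y => Subtype.ext_iff.trans (cellOf_fibers_eq_iff (o n) x y)
  have aux : ∀ {m : ℕ → ℕ}, StrictMono m → (∀ n, Even (m n) ↔ Even n) →
      IsContractionSeq m ∧ IsContractionSeq fun n => c (m n) := fun hm h =>
    ⟨isContractionSeq_of_even_iff hm h, isContractionSeq_of_even_iff (hc.comp hm)
      fun n => (hpar _).trans (h n)⟩
  -- The sequences `0, 3, 4, 7, 8, …` and `2, 5, 6, 9, 10, …`.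
  obtain ⟨a1, a2⟩ := aux (m := fun n => 2 * n + n % 2)
    (strictMono_nat_of_lt_succ fun n => by omega) (fun n => by grind)
  obtain ⟨b1, b2⟩ := aux (m := fun n => 2 * n + n % 2 + 2)
    (strictMono_nat_of_lt_succ fun n => by omega) (fun n => by grind)
  have e1 : F ≈ H := LDiag.equiv_of_subsequences hσ hF hp hH hHl a2 a1 (Nat.zero_le _)
    (Nat.zero_le _) fun n x y => by
      rw [hker, hA]
      change (2 * n + n % 2) % 4 = 0 ∨ (2 * n + n % 2) % 4 = 3
      rcases Nat.mod_two_eq_zero_or_one n with h | h <;> omega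
  have e2 : G ≈ H := LDiag.equiv_of_subsequences hσ hG hq hH hHl b2 b1 (Nat.zero_le _)
    (Nat.zero_le _) fun n x y => by
      rw [hker, hA']
      change ¬ ((2 * n + n % 2 + 2) % 4 = 0 ∨ (2 * n + n % 2 + 2) % 4 = 3)
      rcases Nat.mod_two_eq_zero_or_one n with h | h <;> omega
  exact Setoid.trans e1 (Setoid.symm e2)

end Mixing

/-! ### The maps between the classes -/

section Maps

open ColoredDiagram

/-- The `l`-diagram of a refined sequence of partitions. -/
def LDiag.ofRefinedSeq {X : Type u} [TopologicalSpace X] {σ : X → X} (hσ : IsLHomeo σ)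
    {P : ℕ → Set (Set X)} (hP : IsRefinedSeq σ P) : LDiag.{u} :=
  ⟨diagramOf σ P, isLDiagram_diagramOf hσ hP⟩

/-- Diagrams of refined sequences of conjugate systems are equivalent. -/
theorem LDiag.equiv_of_conj {S T : LHomeo.{u}} (h : S.Conj T) {P : ℕ → Set (Set S.X)}
    {Q : ℕ → Set (Set T.X)} (hP : IsRefinedSeq S.σ P) (hQ : IsRefinedSeq T.σ Q) :
    LDiag.ofRefinedSeq S.isLHomeo hP ≈ LDiag.ofRefinedSeq T.isLHomeo hQ := by
  obtain ⟨h, hh⟩ := h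
  exact LDiag.equiv_of_represents (F := .ofRefinedSeq S.isLHomeo hP)
    (G := .ofRefinedSeq T.isLHomeo hQ) S.isLHomeo
    (represents_diagramOf hP.isPartition (hP.isLabelling S.isLHomeo))
    (isLabelling_cellLabel hP.isPartition (hP.isLabelling S.isLHomeo))
    ((represents_diagramOf hQ.isPartition (hQ.isLabelling T.isLHomeo)).comp_equiv h.toEquiv hh)
    ((isLabelling_cellLabel hQ.isPartition (hQ.isLabelling T.isLHomeo)).comp_homeomorph h hh)

/-- The map from systems to diagrams. -/
noncomputable def toDiag : Quotient LHomeo.setoid.{u} → Quotient LDiag.setoid.{u} :=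
  Quotient.lift (fun S => Quotient.mk _
      (LDiag.ofRefinedSeq S.isLHomeo (exists_isRefinedSeq S.isLHomeo).choose_spec))
    fun _ _ h => Quotient.sound (LDiag.equiv_of_conj h _ _)

theorem toDiag_mk (S : LHomeo.{u}) {P : ℕ → Set (Set S.X)} (hP : IsRefinedSeq S.σ P) :
    toDiag (Quotient.mk _ S) = Quotient.mk _ (LDiag.ofRefinedSeq S.isLHomeo hP) :=
  Quotient.sound (LDiag.equiv_of_conj (Setoid.refl S) _ hP)

/-- The system `(X_F, σ_F)` of an `l`-diagram. -/
noncomputable def LDiag.system (F : LDiag.{u}) : LHomeo.{u} :=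
  ⟨F.1.PathSpace, F.2.shift, F.2.isLHomeo_shift⟩

theorem LDiag.system_conj_of_iso {F G : LDiag.{u}} (h : F.1.Iso G.1) :
    F.system.Conj G.system := by
  obtain ⟨φ, ψ, hr, hs, -, hB, hRv, -⟩ := h
  have := F.2.topology_props.2.1
  refine G.2.exists_conj F.2.shift (fun n x => φ n (vert n x))
    (fun n => (IsLDiagram.isLocallyConstant_vert n).comp (φ n))
    (fun n => (φ n).surjective.comp (F.2.vert_surjective n))
    (fun x y h => F.2.path_ext fun N => ⟨N, le_rfl, (φ N).injective (h N)⟩) ?_ ?_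
  · intro n x
    have h1 : ψ n (x.1 n) ∈ G.1.B (φ n (vert n x)) := hB n _ ▸ ⟨x.1 n, ⟨(x.2 n).1, rfl⟩, rfl⟩
    exact ⟨ψ n (x.1 n), h1.1, by rw [hs, s_eq_vert], h1.2⟩
  · intro n hn x
    obtain ⟨f, hf, hfs, hfr⟩ := F.2.exists_red_shift_odd hn x
    have h1 : ψ n f ∈ G.1.Rv (φ n (F.1.r f)) := hRv n _ ▸ ⟨f, ⟨hf, rfl⟩, rfl⟩
    exact ⟨ψ n f, h1.1, by rw [hs, hfs], by rw [hr, hfr]⟩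

/-- The path space of a contraction is that of the diagram, since the red edges in the definition of
`ShiftRel` combine to red edges of the contraction. -/
theorem LDiag.system_conj_of_contracts {F G : LDiag.{u}} (h : F.Contracts G) :
    F.system.Conj G.system := by
  obtain ⟨G, hG⟩ := G
  obtain ⟨m, hm, rfl⟩ := h
  have := F.2.topology_props.2.1
  refine IsLDiagram.exists_conj (F := F.1.contract m hm.1) hG F.2.shift (fun n x => vert (m n) x)
    (fun n => IsLDiagram.isLocallyConstant_vert (m n)) (fun n => F.2.vert_surjective (m n))
    (fun x y h => F.2.path_ext fun N => ⟨m N, hm.1.id_le N, h N⟩) ?_ ?_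
  · intro n x
    exact ⟨Sum.inl ⟨⟨fun i _ _ => vert i x, fun i _ _ => x.1 i, fun i _ _ => rfl,
      fun i _ _ => s_eq_vert i x⟩, fun i _ _ => (x.2 i).1⟩, ⟨_, rfl⟩, rfl, rfl⟩
  · intro n hn x
    obtain ⟨f, h1, h2, h3, h4⟩ := (F.2.shiftRel_iff_shift x _).2 rfl
    have hs : ∀ i, Odd i → F.1.s (f i) = vert (i + 1) x := by
      rintro _ ⟨j, rfl⟩
      rw [(h3 (2 * j) (even_two_mul j)).2.1, s_eq_vert]
    have hmn : Odd (m n) := by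
      rw [← Nat.not_even_iff_odd, hm.even_iff, Nat.not_even_iff_odd]
      exact hn
    have hmn' : Even (m (n + 1)) := (hm.even_iff _).2 hn.add_one
    refine ⟨Sum.inr ⟨⟨fun i _ _ => F.1.r (f i), fun i _ _ => f i, fun i _ _ => rfl,
      fun i _ _ => h2 i⟩, fun i _ _ => h1 i, fun i _ _ hi => (h3 i hi).2.2⟩, ?_, ?_, ?_⟩
    · rintro ⟨_, h⟩
      cases h
    · exact (h3 _ hmn').1
    · exact (h4 _ hmn).1.symm

/-- The map from diagrams to systems. -/
noncomputable def toSystem : Quotient LDiag.setoid.{u} → Quotient LHomeo.setoid.{u} :=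
  Quotient.lift (fun F => Quotient.mk _ F.system) fun F G h => by
    induction h with
    | rel F G h =>
      rcases h with h | h
      · exact Quotient.sound (LDiag.system_conj_of_iso h)
      · exact Quotient.sound (LDiag.system_conj_of_contracts h)
    | refl F => rfl
    | symm F G _ ih => exact ih.symm
    | trans F G H _ _ ih ih' => exact ih.trans ih'

theorem toSystem_toDiag (S : Quotient LHomeo.setoid.{u}) : toSystem (toDiag S) = S := by
  induction S using Quotient.inductionOn with
  | h S =>
    obtain ⟨P, hP⟩ := exists_isRefinedSeq S.isLHomeo
    rw [toDiag_mk S hP]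
    have := S.isLHomeo.compact
    have hp := hP.isLabelling S.isLHomeo
    have hl := isLabelling_cellLabel hP.isPartition hp
    have hR := represents_diagramOf hP.isPartition hp
    refine Quotient.sound (Setoid.symm ?_)
    exact (isLDiagram_diagramOf S.isLHomeo hP).exists_conj S.σ (cellLabel hP.isPartition)
      hl.locConst hR.surj hl.separates (fun n x => hR.exists_blue n.zero_le x)
      (fun n hn x => hR.exists_red_odd n.zero_le hn x)

theorem toDiag_toSystem (F : Quotient LDiag.setoid.{u}) : toDiag (toSystem F) = F := by
  induction F using Quotient.inductionOn with
  | h F =>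
    -- The contraction to the layers from `2` on removes multiple red edges.
    have hm : IsContractionSeq fun n => n + 2 :=
      isContractionSeq_of_even_iff (strictMono_nat_of_lt_succ fun n => by omega)
        fun n => by grind
    have hF := F.2.represents_vert
    have hp := F.2.isLabelling_vert
    have hσ := F.2.isLHomeo_shift
    have := hσ.compact
    have := hσ.nonempty
    have hG := hF.contract hp hm le_rfl
    have hq := hp.comp_seq hm.1 hm.even_iff le_rfl
    let G : LDiag.{u} := ⟨_, hG.isLDiagram hq hσ.surjective (hasColorSep_contract _ _ _)⟩
    have hFG : F ≈ G := LDiag.equiv_of_contracts ⟨_, hm, rfl⟩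
    obtain ⟨P, hP⟩ := exists_isRefinedSeq hσ
    refine (toDiag_mk F.system hP).trans (Quotient.sound (Setoid.trans ?_ (Setoid.symm hFG)))
    exact LDiag.equiv_of_represents (F := .ofRefinedSeq hσ hP) (G := G) hσ
      (represents_diagramOf hP.isPartition (hP.isLabelling hσ))
      (isLabelling_cellLabel hP.isPartition (hP.isLabelling hσ)) hG hq

end Maps
end LCorr

theorem theorem3p7 :
    ∃ (Φ : Quotient LCorr.LHomeo.setoid.{u} → Quotient LCorr.LDiag.setoid.{u})
      (Ψ : Quotient LCorr.LDiag.setoid.{u} → Quotient LCorr.LHomeo.setoid.{u}),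
      -- `Φ` is given by the diagram of an arbitrary refined sequence of partitions
      (∀ S : LCorr.LHomeo.{u},
        (∃ P : ℕ → Set (Set S.X), LCorr.IsRefinedSeq S.σ P) ∧
        ∀ P : ℕ → Set (Set S.X), LCorr.IsRefinedSeq S.σ P →
          ∃ h : (LCorr.diagramOf S.σ P).IsLDiagram,
            Φ (Quotient.mk _ S) = Quotient.mk _ ⟨LCorr.diagramOf S.σ P, h⟩) ∧
      -- `Ψ` is given by the path space and the map defined through rombs
      (∀ F : LCorr.LDiag.{u},
        ∃ σ : F.1.PathSpace → F.1.PathSpace,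
          (∀ x y, F.1.ShiftRel x y ↔ σ x = y) ∧
          ∃ h : LCorr.IsLHomeo σ,
            Ψ (Quotient.mk _ F) = Quotient.mk _ ⟨F.1.PathSpace, σ, h⟩) ∧
      Function.LeftInverse Ψ Φ ∧ Function.RightInverse Ψ Φ := by
  refine ⟨LCorr.toDiag, LCorr.toSystem, fun S => ⟨LCorr.exists_isRefinedSeq S.isLHomeo,
    fun P hP => ⟨_, LCorr.toDiag_mk S hP⟩⟩, fun F => ⟨F.2.shift, F.2.shiftRel_iff_shift,
    F.2.isLHomeo_shift, rfl⟩, LCorr.toSystem_toDiag, LCorr.toDiag_toSystem⟩
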